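/- **Setting.** Expressions are $A,B,a,b ::= s \mid x \mid (x{:}A)\to B \mid \lambda x{:}A.\,b \mid a\,b$ with sorts $s\in\{\ast,\Box\}$, up to renaming of bound variables. One-step reduction $\leadsto$ is the closure of $(\lambda x{:}A.\,b)\,a\leadsto[a/x]b$ under all expression formers (in both components of products, abstractions and applications); $=_\beta$ is its reflexive, symmetric, transitive closure. $\Gamma\vdash_{CC}a:A$ and $\Gamma\vdash_{F_\omega}a:A$ are the typing judgements of the pure type systems with sorts $\{\ast,\Box\}$, axiom $(\ast,\Box)$ and product rules $\{(\ast,\ast,\ast),(\Box,\ast,\ast),(\Box,\Box,\Box),(\ast,\Box,\Box)\}$ for CC, respectively $\{(\ast,\ast,\ast),(\Box,\ast,\ast),(\Box,\Box,\Box)\}$ for $F_\omega$. In each system, $A$ is a *kind* if $\Gamma\vdash A:\Box$ for some $\Gamma$. In CC, $a$ is a *$\Gamma$-type* if $\Gamma\vdash a:\ast$; it is a *$\Gamma$-constructor* (resp. a *$\Gamma$-term*) if $\Gamma\vdash a:B$ for some $B$ with $\Gamma\vdash B:\Box$ (resp. $\Gamma\vdash B:\ast$). **Translations.** Fix variables $0$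 and $z$ not occurring in source expressions and, for each variable $x$, a further variable $w^x$. On sorts and kinds of CC, $V(\Box)=V(\ast)=\ast$, and $V((x{:}A)\to B)$ is $V(A)\to V(B)$ if $A$ is a kind and $V(B)$ otherwise. For an $F_\omega$ type $B$ put $c^B=z\,B$; for $F_\omega$ kinds put $c^{\ast}=0$ and $c^{(x:A)\to B}=\lambda x{:}A.\,c^B$. The type translation $\langle\cdot\rangle_\Gamma$, on sorts, kinds and $\Gamma$-constructors of CC, is given by $\langle\Box\rangle_\Gamma=\langle\ast\rangle_\Gamma=0$, $\langle x\rangle_\Gamma=x$ and - $\langle(x{:}A)\to B\rangle_\Gamma=(x{:}V(A))\to\langle A\rangle_\Gamma\to\langle B\rangle_{\Gamma,x:A}$ if $A$ is a kind, and $(x{:}\langle A\rangle_\Gamma)\to\langle B\rangle_{\Gamma,x:A}$ if $A$ is a $\Gamma$-type; - $\langle\lambda x{:}A.\,B\rangle_\Gamma=\lambda x{:}V(A).\,\langle B\rangle_{\Gamma,x:A}$ if $A$ is a kind, and $\langle B\rangle_{\Gamma,x:A}$ if $A$ is a $\Gamma$-type ($x$ does not occur in the latter); - $\langle A\,B\rangle_\Gamma=\langle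 A\rangle_\Gamma\,\langle B\rangle_\Gamma$ if $B$ is a $\Gamma$-constructor, and $\langle A\rangle_\Gamma$ if $B$ is a $\Gamma$-term. The term translation $[\cdot]_\Gamma$, on the expressions that are typable in $\Gamma$ in CC, is given by - $[\ast]_\Gamma=c^{0}$; $[x]_\Gamma=w^x$ if $x$ is a $\Gamma$-constructor, and $[x]_\Gamma=x$ if $x$ is a $\Gamma$-term; - $[(x{:}A)\to B]_\Gamma=c^{0\to0\to0}\,[A]_\Gamma\,\bigl([c^{V(A)}/x][c^{\langle A\rangle_\Gamma}/w^x][B]_{\Gamma,x:A}\bigr)$ if $A$ is a kind, and $c^{0\to0\to0}\,[A]_\Gamma\,\bigl([c^{\langle A\rangle_\Gamma}/x][B]_{\Gamma,x:A}\bigr)$ if $A$ is a $\Gamma$-type; - $[\lambda x{:}A.\,b]_\Gamma=\bigl(\lambda y{:}0.\,\lambda x{:}V(A).\,\lambda w^x{:}\langle A\rangle_\Gamma.\,[b]_{\Gamma,x:A}\bigr)\,[A]_\Gamma$ if $A$ is a kind, and $\bigl(\lambda y{:}0.\,\lambda x{:}\langle A\rangle_\Gamma.\,[b]_{\Gamma,x:A}\bigr)\,[A]_\Gamma$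 if $A$ is a $\Gamma$-type, with $y$ fresh; - $[A\,B]_\Gamma=[A]_\Gamma\,\langle B\rangle_\Gamma\,[B]_\Gamma$ if $B$ is a $\Gamma$-constructor, and $[A]_\Gamma\,[B]_\Gamma$ if $B$ is a $\Gamma$-term. **Theorem (term translation preserves reduction).** If $\Gamma\vdash_{CC}a:A$ and $a\leadsto a'$, then $[a]_\Gamma$ reduces to $[a']_\Gamma$ in at least one step of $\leadsto$. -/

import Mathlib

namespace PTS

/-- The sorts `∗` and `□`. -/
inductive Srt : Type
  | star
  | box
  deriving DecidableEq

/-- Raw expressions of a pure type system, with de Bruijn indices: `pi A B` is `(x : A) → B`,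
`lam A b` is `λ x : A. b`; in both, index `0` of the second argument is the bound variable. -/
inductive Expr : Type
  | sort (s : Srt)
  | var (n : ℕ)
  | pi (A B : Expr)
  | lam (A b : Expr)
  | app (a b : Expr)

namespace Expr

/-- Extension of a renaming under one binder. -/
def upr (ρ : ℕ → ℕ) : ℕ → ℕ
  | 0 => 0
  | n + 1 => ρ n + 1

/-- Renaming of the free variables. -/
def rename : (ℕ → ℕ) → Expr → Expr
  | _, sort s => sort s
  | ρ, var n => var (ρ n)
  | ρ, pi A B => pi (rename ρ A) (rename (upr ρ) B)
  | ρ, lam A b => lam (rename ρ A) (rename (upr ρ) b)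
  | ρ, app a b => app (rename ρ a) (rename ρ b)

/-- Weakening by one fresh variable. -/
def lift (a : Expr) : Expr := rename (fun n => n + 1) a

/-- Extension of a substitution under one binder. -/
def ups (σ : ℕ → Expr) : ℕ → Expr
  | 0 => var 0
  | n + 1 => lift (σ n)

/-- Simultaneous capture-avoiding substitution. -/
def subst : (ℕ → Expr) → Expr → Expr
  | _, sort s => sort s
  | σ, var n => σ n
  | σ, pi A B => pi (subst σ A) (subst (ups σ) B)
  | σ, lam A b => lam (subst σ A) (subst (ups σ) b)
  | σ, app a b => app (subst σ a) (subst σ b)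

/-- The substitution of `b` for index `0`, all other variables being lowered by one. -/
def single (b : Expr) : ℕ → Expr
  | 0 => b
  | n + 1 => var n

/-- `a.inst b` is `[b/x] a`, where `x` is the variable with index `0` of `a`. -/
def inst (a b : Expr) : Expr := subst (single b) a

/-- The nondependent product `A → B`. -/
def arrow (A B : Expr) : Expr := pi A (lift B)

end Expr

open PTS.Expr

/-- One-step reduction `a ⟶ b`. -/
inductive Step : Expr → Expr → Prop
  | beta (A b a : Expr) : Step (app (lam A b) a) (b.inst a)
  | pi1 {A A' : Expr} (B : Expr) : Step A A' → Step (pi A B) (pi A' B)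
  | pi2 (A : Expr) {B B' : Expr} : Step B B' → Step (pi A B) (pi A B')
  | lam1 {A A' : Expr} (b : Expr) : Step A A' → Step (lam A b) (lam A' b)
  | lam2 (A : Expr) {b b' : Expr} : Step b b' → Step (lam A b) (lam A b')
  | app1 {a a' : Expr} (b : Expr) : Step a a' → Step (app a b) (app a' b)
  | app2 (a : Expr) {b b' : Expr} : Step b b' → Step (app a b) (app a b')

/-- Beta conversion: the reflexive, symmetric, transitive closure of reduction. -/
def Conv : Expr → Expr → Prop := Relation.EqvGen Step

/-- Reduction in at least one step. -/
def StepPlus : Expr → Expr → Prop := Relation.TransGen Step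

/-- Contexts, innermost binding first: in `A :: Γ`, the expression `A` lives in `Γ`. -/
abbrev Ctx : Type := List Expr

/-- The axioms: `(∗, □)` only. -/
inductive Ax : Srt → Srt → Prop
  | star_box : Ax Srt.star Srt.box

mutual

/-- The typing judgement `Γ ⊢ a : A` of the pure type system with sorts `∗`, `□`, the axiom
`(∗, □)` and the set `R` of product rules. -/
inductive Typing (R : Set (Srt × Srt × Srt)) : Ctx → Expr → Expr → Prop
  | sort {Γ : Ctx} {s₁ s₂ : Srt} : WfCtx R Γ → Ax s₁ s₂ → Typing R Γ (sort s₁) (sort s₂)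
  | var {Γ : Ctx} {n : ℕ} {A : Expr} : WfCtx R Γ → Γ[n]? = some A →
      Typing R Γ (var n) (A.rename (fun k => k + (n + 1)))
  | pi {Γ : Ctx} {A B : Expr} {s₁ s₂ s₃ : Srt} : Typing R Γ A (sort s₁) →
      Typing R (A :: Γ) B (sort s₂) → (s₁, s₂, s₃) ∈ R → Typing R Γ (pi A B) (sort s₃)
  | lam {Γ : Ctx} {A B b : Expr} {s : Srt} : Typing R Γ (pi A B) (sort s) →
      Typing R (A :: Γ) b B → Typing R Γ (lam A b) (pi A B)
  | app {Γ : Ctx} {A B a b : Expr} : Typing R Γ a (pi A B) → Typing R Γ b A →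
      Typing R Γ (app a b) (B.inst b)
  | conv {Γ : Ctx} {A B a : Expr} {s : Srt} : Typing R Γ a A → Typing R Γ B (sort s) →
      Conv A B → Typing R Γ a B

/-- The judgement `⊢ Γ` (well-formed context). -/
inductive WfCtx (R : Set (Srt × Srt × Srt)) : Ctx → Prop
  | nil : WfCtx R []
  | cons {Γ : Ctx} {A : Expr} {s : Srt} : Typing R Γ A (sort s) → WfCtx R (A :: Γ)

end

/-- The product rules of System F-omega. -/
def rulesFω : Set (Srt × Srt × Srt) :=
  {(.star, .star, .star), (.box, .star, .star), (.box, .box, .box)}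

/-- The product rules of the calculus of constructions. -/
def rulesCC : Set (Srt × Srt × Srt) :=
  {(.star, .star, .star), (.box, .star, .star), (.box, .box, .box), (.star, .box, .box)}

/-- `A` is a kind: it has type `□` (in some context). -/
def IsKind (R : Set (Srt × Srt × Srt)) (A : Expr) : Prop :=
  ∃ Γ : Ctx, Typing R Γ A (sort .box)

/-- `a` is a `Γ`-constructor: its type has type `□`. -/
def IsConstructor (R : Set (Srt × Srt × Srt)) (Γ : Ctx) (a : Expr) : Prop :=
  ∃ B : Expr, Typing R Γ a B ∧ Typing R Γ B (sort .box)

/-- The de Bruijn indices, in the current target scope, of the variables that occur in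
translations: `x n` and `w n` are the indices of the target variables `x` and `w^x` that belong to
the source variable `x` with index `n`; `zero` and `z` are those of the two fixed variables `0`
and `z`. -/
structure Names : Type where
  x : ℕ → ℕ
  w : ℕ → ℕ
  zero : ℕ
  z : ℕ

namespace Names

/-- Below a source binder `x` and a target binder `x` (there is no `w^x`; its entry is a dummy). -/
def bind (E : Names) : Names where
  x := fun n => Nat.casesOn n 0 (fun m => E.x m + 1)
  w := fun n => Nat.casesOn n 0 (fun m => E.w m + 1)
  zero := E.zero + 1
  z := E.z + 1

/-- Below a source binder `x` and two target binders, `x` and then `w^x`. -/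
def bindKind (E : Names) : Names where
  x := fun n => Nat.casesOn n 1 (fun m => E.x m + 2)
  w := fun n => Nat.casesOn n 0 (fun m => E.w m + 2)
  zero := E.zero + 2
  z := E.z + 2

/-- Below a source binder `x` that the translation erases (the entries of `x` are dummies). -/
def erase (E : Names) : Names where
  x := fun n => Nat.casesOn n E.zero E.x
  w := fun n => Nat.casesOn n E.zero E.w
  zero := E.zero
  z := E.z

open Classical in
/-- The variables of the translated context: it starts with `0` and `z`, and then has two variables
`x`, `w^x` for each binding `x : A` of the source context with `A` a kind, and one variable `x` for
each other binding. -/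
noncomputable def ofCtx : Ctx → Names
  | [] => { x := fun _ => 0, w := fun _ => 0, zero := 1, z := 0 }
  | A :: Γ => if IsKind rulesCC A then (ofCtx Γ).bindKind else (ofCtx Γ).bind

end Names

open Classical in
/-- The translation `V` of sorts and kinds (the last clause is not used). -/
noncomputable def V : Expr → Expr
  | sort _ => sort .star
  | pi A B => if IsKind rulesCC A then arrow (V A) (V B) else V B
  | _ => sort .star

open Classical in
/-- The canonical inhabitant `c^B`: `z B` if `B` is an F-omega type, and `c^∗ = 0`,
`c^((x : A) → B) = λ x : A. c^B` for F-omega kinds. Here `o` and `z` are the indices of the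
variables `0` and `z`. -/
noncomputable def canon : ℕ → ℕ → Expr → Expr
  | o, _, sort _ => var o
  | o, z, pi A B =>
      if IsKind rulesFω (pi A B) then lam A (canon (o + 1) (z + 1) B)
      else app (var z) (pi A B)
  | _, z, B => app (var z) B

open Classical in
/-- The type translation, on sorts, kinds and `Γ`-constructors; `E` gives the indices of the target
variables. On this domain, by classification, the domain `A` of a product or abstraction is either a
kind or a `Γ`-type, and an argument `B` is either a `Γ`-constructor or a `Γ`-term. -/
noncomputable def typAux : Ctx → Names → Expr → Expr
  | _, E, sort _ => var E.zero
  | _, E, var n => var (E.x n)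
  | Γ, E, pi A B =>
      if IsKind rulesCC A then
        pi (V A) (arrow (typAux Γ E A).lift (typAux (A :: Γ) E.bind B))
      else pi (typAux Γ E A) (typAux (A :: Γ) E.bind B)
  | Γ, E, lam A B =>
      if IsKind rulesCC A then lam (V A) (typAux (A :: Γ) E.bind B)
      else typAux (A :: Γ) E.erase B
  | Γ, E, app A B =>
      if IsConstructor rulesCC Γ B then app (typAux Γ E A) (typAux Γ E B)
      else typAux Γ E A

open Classical in
/-- The term translation, on the expressions that are typable in `Γ`; `E` gives the indices of the
target variables. The same remark on the case distinctions applies; the sort `□` is not typable, so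
that the first clause is about `∗` only. -/
noncomputable def trmAux : Ctx → Names → Expr → Expr
  | _, E, sort _ => canon E.zero E.z (var E.zero)
  | Γ, E, var n => if IsConstructor rulesCC Γ (var n) then var (E.w n) else var (E.x n)
  | Γ, E, pi A B =>
      let c₀ := canon E.zero E.z (arrow (var E.zero) (arrow (var E.zero) (var E.zero)))
      let cA := canon E.zero E.z (typAux Γ E A)
      if IsKind rulesCC A then
        app (app c₀ (trmAux Γ E A))
          (((trmAux (A :: Γ) E.bindKind B).inst cA.lift).inst (canon E.zero E.z (V A)))
      else
        app (app c₀ (trmAux Γ E A)) ((trmAux (A :: Γ) E.bind B).inst cA)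
  | Γ, E, lam A b =>
      if IsKind rulesCC A then
        app (lam (var E.zero)
            (lam (V A) (lam (typAux Γ E A).lift (trmAux (A :: Γ) E.bindKind b))).lift)
          (trmAux Γ E A)
      else
        app (lam (var E.zero) (lam (typAux Γ E A) (trmAux (A :: Γ) E.bind b)).lift)
          (trmAux Γ E A)
  | Γ, E, app A B =>
      if IsConstructor rulesCC Γ B then
        app (app (trmAux Γ E A) (typAux Γ E B)) (trmAux Γ E B)
      else app (trmAux Γ E A) (trmAux Γ E B)

/-- The term translation of `a` with respect to `Γ`, an expression over the translated context. -/
noncomputable def trm (Γ : Ctx) (a : Expr) : Expr := trmAux Γ (Names.ofCtx Γ) a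

end PTS

namespace PTS

namespace Expr

/-! ### Renaming and substitution -/

-- The translations commute with substitution. For a constructor argument,
-- $\langle[a/x]b\rangle=[\langle a\rangle/x]\langle b\rangle$ and $[[a/x]b]$ is $[b]$ with $\langle
-- a\rangle$ for $x$ and $[a]$ for $w^x$. For a term argument, $\langle b\rangle$ is unchanged and
-- $[b]$ receives $[a]$ for $x$ (`typS_subst`, `trmS_subst`). Hence a contracted redex is simulated
-- exactly: one target step discards the dummy argument $[A]$, and two steps (kind domain) or one
-- (type domain) perform the substitution.
--
-- In the congruence cases three strengths of invariance cooperate. $V$ does not change when a kind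
-- reduces (`kindS_step`); $\langle\cdot\rangle$ makes zero or more steps, since the redex may be
-- erased (`typS_step`); $[\cdot]$ makes at least one, because every immediate subexpression keeps a
-- copy under $[\cdot]$. For the domain of an abstraction that copy is the dummy argument.
--
-- The obstacle is that the clauses are selected by typability, which is awkward under substitution.
-- By classification, the selection depends on shape only: `isK` recognizes kinds, and `isT`, given
-- which variables are terms, recognizes terms (`isK_iff`, `isT_iff`). This rests on confluence,
-- subject reduction and uniqueness of types. On typable expressions the translations thus agree
-- with the structural versions `typS` and `trmS`, whose substitution lemmas need only `Stratified`,
-- not typing.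

theorem upr_comp (ρ ξ : ℕ → ℕ) : upr (fun n => ρ (ξ n)) = fun n => upr ρ (upr ξ n) := by
  funext n; cases n <;> rfl

theorem rename_rename (a : Expr) (ρ ξ : ℕ → ℕ) :
    rename ρ (rename ξ a) = rename (fun n => ρ (ξ n)) a := by
  induction a generalizing ρ ξ <;> simp_all [rename, upr_comp]

theorem ups_comp_upr (σ : ℕ → Expr) (ξ : ℕ → ℕ) :
    ups (fun n => σ (ξ n)) = fun n => ups σ (upr ξ n) := by
  funext n; cases n <;> rfl

theorem subst_rename (a : Expr) (σ : ℕ → Expr) (ξ : ℕ → ℕ) :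
    subst σ (rename ξ a) = subst (fun n => σ (ξ n)) a := by
  induction a generalizing σ ξ <;> simp_all [rename, subst, ups_comp_upr]

theorem rename_upr_lift (ρ : ℕ → ℕ) (a : Expr) : rename (upr ρ) (lift a) = lift (rename ρ a) := by
  simp [lift, rename_rename, upr]

theorem ups_rename (ρ : ℕ → ℕ) (σ : ℕ → Expr) :
    ups (fun n => rename ρ (σ n)) = fun n => rename (upr ρ) (ups σ n) := by
  funext n; cases n
  · rfl
  · simp [ups, rename_upr_lift]

theorem rename_subst (a : Expr) (ρ : ℕ → ℕ) (σ : ℕ → Expr) :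
    rename ρ (subst σ a) = subst (fun n => rename ρ (σ n)) a := by
  induction a generalizing ρ σ <;> simp_all [rename, subst, ups_rename]

theorem subst_ups_lift (σ : ℕ → Expr) (a : Expr) : subst (ups σ) (lift a) = lift (subst σ a) := by
  simp only [lift, subst_rename, rename_subst]; rfl

theorem ups_subst (τ σ : ℕ → Expr) :
    ups (fun n => subst τ (σ n)) = fun n => subst (ups τ) (ups σ n) := by
  funext n; cases n
  · rfl
  · simp [ups, subst_ups_lift]

theorem subst_subst (a : Expr) (τ σ : ℕ → Expr) :
    subst τ (subst σ a) = subst (fun n => subst τ (σ n)) a := by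
  induction a generalizing τ σ <;> simp_all [subst, ups_subst]

theorem ups_var : ups var = var := by funext n; cases n <;> rfl

theorem subst_var (a : Expr) : subst var a = a := by
  induction a <;> simp_all [subst, ups_var]

theorem ups_var_comp (ρ : ℕ → ℕ) : ups (fun n => var (ρ n)) = fun n => var (upr ρ n) := by
  funext n; cases n <;> rfl

theorem rename_eq_subst (a : Expr) (ρ : ℕ → ℕ) : rename ρ a = subst (fun n => var (ρ n)) a := by
  induction a generalizing ρ <;> simp_all [rename, subst, ups_var_comp]

theorem subst_single_lift (a b : Expr) : subst (single b) (lift a) = a := by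
  rw [lift, subst_rename]; exact subst_var a

theorem inst_lift (a b : Expr) : (lift a).inst b = a := subst_single_lift a b

theorem subst_inst (a b : Expr) (σ : ℕ → Expr) :
    subst σ (a.inst b) = (subst (ups σ) a).inst (subst σ b) := by
  simp only [inst, subst_subst]
  congr 1; funext n; cases n
  · rfl
  · simp [ups, single, subst_single_lift, subst]

theorem rename_inst (a b : Expr) (ρ : ℕ → ℕ) :
    rename ρ (a.inst b) = (rename (upr ρ) a).inst (rename ρ b) := by
  simp only [rename_eq_subst, subst_inst, ups_var_comp]

theorem lift_subst (a : Expr) (σ : ℕ → Expr) : lift (subst σ a) = subst (ups σ) (lift a) :=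
  (subst_ups_lift σ a).symm

theorem subst_arrow (A B : Expr) (σ : ℕ → Expr) :
    subst σ (arrow A B) = arrow (subst σ A) (subst σ B) := by
  simp [arrow, subst, subst_ups_lift]

theorem rename_arrow (A B : Expr) (ρ : ℕ → ℕ) :
    rename ρ (arrow A B) = arrow (rename ρ A) (rename ρ B) := by
  simp [arrow, rename, rename_upr_lift]

end Expr

open PTS.Expr

/-! ### Confluence -/

/-- Reduction in any number of steps. -/
def Steps : Expr → Expr → Prop := Relation.ReflTransGen Step

theorem Steps.refl (a : Expr) : Steps a a := Relation.ReflTransGen.refl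

theorem Steps.trans {a b c : Expr} (h : Steps a b) (h' : Steps b c) : Steps a c :=
  Relation.ReflTransGen.trans h h'

theorem Steps.map {f : Expr → Expr} (hf : ∀ a b, Step a b → Step (f a) (f b)) {a b : Expr}
    (h : Steps a b) : Steps (f a) (f b) :=
  Relation.ReflTransGen.lift f hf _ _ h

theorem StepPlus.map {f : Expr → Expr} (hf : ∀ a b, Step a b → Step (f a) (f b)) {a b : Expr}
    (h : StepPlus a b) : StepPlus (f a) (f b) :=
  Relation.TransGen.lift f hf _ _ h

theorem Steps.pi {A A' B B' : Expr} (hA : Steps A A') (hB : Steps B B') :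
    Steps (Expr.pi A B) (Expr.pi A' B') :=
  Steps.trans (hA.map (f := (fun A => Expr.pi A B)) (fun _ _ => Step.pi1 B))
    (hB.map (f := (fun B => Expr.pi A' B)) (fun _ _ => Step.pi2 A'))

theorem Steps.lam {A A' b b' : Expr} (hA : Steps A A') (hb : Steps b b') :
    Steps (Expr.lam A b) (Expr.lam A' b') :=
  Steps.trans (hA.map (f := (fun A => Expr.lam A b)) (fun _ _ => Step.lam1 b))
    (hb.map (f := (fun b => Expr.lam A' b)) (fun _ _ => Step.lam2 A'))

theorem Steps.app {a a' b b' : Expr} (ha : Steps a a') (hb : Steps b b') :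
    Steps (Expr.app a b) (Expr.app a' b') :=
  Steps.trans (ha.map (f := (fun a => Expr.app a b)) (fun _ _ => Step.app1 b))
    (hb.map (f := (fun b => Expr.app a' b)) (fun _ _ => Step.app2 a'))

theorem Step.subst {a b : Expr} (h : Step a b) (σ : ℕ → Expr) :
    Step (a.subst σ) (b.subst σ) := by
  induction h generalizing σ with
  | beta A b a => rw [subst_inst]; exact Step.beta _ _ _
  | pi1 B _ ih => exact Step.pi1 _ (ih σ)
  | pi2 A _ ih => exact Step.pi2 _ (ih _)
  | lam1 b _ ih => exact Step.lam1 _ (ih σ)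
  | lam2 A _ ih => exact Step.lam2 _ (ih _)
  | app1 b _ ih => exact Step.app1 _ (ih σ)
  | app2 a _ ih => exact Step.app2 _ (ih σ)

theorem Steps.subst {a b : Expr} (h : Steps a b) (σ : ℕ → Expr) :
    Steps (a.subst σ) (b.subst σ) :=
  h.map (f := fun a => a.subst σ) fun _ _ h => h.subst σ

theorem StepPlus.subst {a b : Expr} (h : StepPlus a b) (σ : ℕ → Expr) :
    StepPlus (a.subst σ) (b.subst σ) :=
  h.map (f := fun a => a.subst σ) fun _ _ h => h.subst σ

theorem Steps.rename {a b : Expr} (h : Steps a b) (ρ : ℕ → ℕ) :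
    Steps (a.rename ρ) (b.rename ρ) := by
  simpa only [rename_eq_subst] using h.subst _

theorem Steps.ups {σ τ : ℕ → Expr} (h : ∀ n, Steps (σ n) (τ n)) (n : ℕ) :
    Steps (ups σ n) (ups τ n) := by
  cases n with
  | zero => exact Steps.refl _
  | succ n => exact (h n).rename _

theorem Steps.subst_right (a : Expr) {σ τ : ℕ → Expr} (h : ∀ n, Steps (σ n) (τ n)) :
    Steps (a.subst σ) (a.subst τ) := by
  induction a generalizing σ τ with
  | sort s => exact Steps.refl _
  | var n => exact h n
  | pi A B ihA ihB => exact (ihA h).pi (ihB (Steps.ups h))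
  | lam A b ihA ihb => exact (ihA h).lam (ihb (Steps.ups h))
  | app a b iha ihb => exact (iha h).app (ihb h)

theorem Steps.inst_right (a : Expr) {b b' : Expr} (h : Steps b b') :
    Steps (a.inst b) (a.inst b') := by
  refine Steps.subst_right a fun n => ?_
  cases n
  · exact h
  · exact Steps.refl _

/-- Parallel reduction. -/
inductive Par : Expr → Expr → Prop
  | sort (s : Srt) : Par (sort s) (sort s)
  | var (n : ℕ) : Par (var n) (var n)
  | pi {A A' B B' : Expr} : Par A A' → Par B B' → Par (pi A B) (pi A' B')
  | lam {A A' b b' : Expr} : Par A A' → Par b b' → Par (lam A b) (lam A' b')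
  | app {a a' b b' : Expr} : Par a a' → Par b b' → Par (app a b) (app a' b')
  | beta (A : Expr) {b b' a a' : Expr} : Par b b' → Par a a' → Par (app (lam A b) a) (b'.inst a')

theorem Par.refl (a : Expr) : Par a a := by
  induction a with
  | sort s => exact .sort s
  | var n => exact .var n
  | pi A B ihA ihB => exact .pi ihA ihB
  | lam A b ihA ihb => exact .lam ihA ihb
  | app a b iha ihb => exact .app iha ihb

theorem Step.par {a b : Expr} (h : Step a b) : Par a b := by
  induction h with
  | beta A b a => exact .beta A (.refl _) (.refl _)
  | pi1 B _ ih => exact .pi ih (.refl _)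
  | pi2 A _ ih => exact .pi (.refl _) ih
  | lam1 b _ ih => exact .lam ih (.refl _)
  | lam2 A _ ih => exact .lam (.refl _) ih
  | app1 b _ ih => exact .app ih (.refl _)
  | app2 a _ ih => exact .app (.refl _) ih

theorem Par.steps {a b : Expr} (h : Par a b) : Steps a b := by
  induction h with
  | sort s => exact .refl _
  | var n => exact .refl _
  | pi _ _ ihA ihB => exact ihA.pi ihB
  | lam _ _ ihA ihb => exact ihA.lam ihb
  | app _ _ iha ihb => exact iha.app ihb
  | beta A _ _ ihb iha =>
    exact (((Steps.refl A).lam ihb).app iha).trans (Relation.ReflTransGen.single (.beta _ _ _))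

theorem Par.rename {a b : Expr} (h : Par a b) (ρ : ℕ → ℕ) : Par (a.rename ρ) (b.rename ρ) := by
  induction h generalizing ρ with
  | sort s => exact .sort s
  | var n => exact .var _
  | pi _ _ ihA ihB => exact .pi (ihA _) (ihB _)
  | lam _ _ ihA ihb => exact .lam (ihA _) (ihb _)
  | app _ _ iha ihb => exact .app (iha _) (ihb _)
  | beta A _ _ ihb iha => rw [rename_inst]; exact .beta _ (ihb _) (iha _)

theorem Par.ups {σ τ : ℕ → Expr} (h : ∀ n, Par (σ n) (τ n)) (n : ℕ) :
    Par (ups σ n) (ups τ n) := by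
  cases n with
  | zero => exact .var 0
  | succ n => exact (h n).rename _

theorem Par.subst {a b : Expr} (h : Par a b) {σ τ : ℕ → Expr} (hσ : ∀ n, Par (σ n) (τ n)) :
    Par (a.subst σ) (b.subst τ) := by
  induction h generalizing σ τ with
  | sort s => exact .sort s
  | var n => exact hσ n
  | pi _ _ ihA ihB => exact .pi (ihA hσ) (ihB (Par.ups hσ))
  | lam _ _ ihA ihb => exact .lam (ihA hσ) (ihb (Par.ups hσ))
  | app _ _ iha ihb => exact .app (iha hσ) (ihb hσ)
  | beta A _ _ ihb iha => rw [subst_inst]; exact .beta _ (ihb (Par.ups hσ)) (iha hσ)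

theorem Par.inst {a a' b b' : Expr} (h : Par a a') (hb : Par b b') :
    Par (a.inst b) (a'.inst b') := by
  refine h.subst fun n => ?_
  cases n
  · exact hb
  · exact .var _

/-- The complete development: all redexes of an expression are contracted. -/
def develop : Expr → Expr
  | sort s => sort s
  | var n => var n
  | pi A B => pi (develop A) (develop B)
  | lam A b => lam (develop A) (develop b)
  | app (lam _ b) a => (develop b).inst (develop a)
  | app a b => app (develop a) (develop b)

/-- Takahashi's triangle property. The complete development depends on the source alone, so it joins
any two parallel reducts, and the diamond property follows without comparing two reductions. -/
theorem Par.develop {a b : Expr} (h : Par a b) : Par b (develop a) := by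
  induction h with
  | sort s => exact .sort s
  | var n => exact .var n
  | pi _ _ ihA ihB => exact .pi ihA ihB
  | lam _ _ ihA ihb => exact .lam ihA ihb
  | @app a a' b b' ha _ iha ihb =>
    cases ha with
    | lam hA hb' =>
      cases iha with
      | lam _ h => exact .beta _ h ihb
    | sort | var | pi | app | beta => exact .app iha ihb
  | beta A _ _ ihb iha => exact ihb.inst iha

theorem Conv.join {a b : Expr} (h : Conv a b) : ∃ c, Steps a c ∧ Steps b c := by
  -- By the diamond property, joinability under parallel reduction is an equivalence relation; it
  -- contains `Step`, hence all of `Conv`.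
  have hP : Relation.Join (Relation.ReflTransGen Par) a b := by
    have he : Equivalence (Relation.Join (Relation.ReflTransGen Par)) :=
      Relation.equivalence_join_reflTransGen fun a b c hb hc =>
        ⟨develop a, .single hb.develop, .single hc.develop⟩
    exact he.eqvGen_iff.1 (Relation.EqvGen.mono (fun _ _ h => ⟨_, .single h.par, .refl⟩) _ _ h)
  have key {a b : Expr} (h : Relation.ReflTransGen Par a b) : Steps a b := by
    induction h with
    | refl => exact .refl _
    | tail _ h ih => exact ih.trans h.steps
  obtain ⟨c, h1, h2⟩ := hP
  exact ⟨c, key h1, key h2⟩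

-- Conversion, and its inversion on sorts and products

theorem Conv.refl (a : Expr) : Conv a a := Relation.EqvGen.refl a

theorem Conv.symm {a b : Expr} (h : Conv a b) : Conv b a := Relation.EqvGen.symm _ _ h

theorem Conv.trans {a b c : Expr} (h : Conv a b) (h' : Conv b c) : Conv a c :=
  Relation.EqvGen.trans _ _ _ h h'

theorem Step.conv {a b : Expr} (h : Step a b) : Conv a b := Relation.EqvGen.rel _ _ h

theorem Steps.conv {a b : Expr} (h : Steps a b) : Conv a b := by
  induction h with
  | refl => exact .refl _
  | tail _ h ih => exact ih.trans h.conv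

theorem Conv.map {f : Expr → Expr} (hf : ∀ a b, Step a b → Step (f a) (f b)) {a b : Expr}
    (h : Conv a b) : Conv (f a) (f b) := by
  induction h with
  | rel _ _ h => exact (hf _ _ h).conv
  | refl => exact .refl _
  | symm _ _ _ ih => exact ih.symm
  | trans _ _ _ _ _ ih ih' => exact ih.trans ih'

theorem Conv.subst {a b : Expr} (h : Conv a b) (σ : ℕ → Expr) :
    Conv (a.subst σ) (b.subst σ) :=
  h.map (f := fun a => a.subst σ) fun _ _ h => h.subst σ

theorem Conv.rename {a b : Expr} (h : Conv a b) (ρ : ℕ → ℕ) :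
    Conv (a.rename ρ) (b.rename ρ) := by
  simpa only [rename_eq_subst] using h.subst _

theorem Steps.sort_eq {s : Srt} {a : Expr} (h : Steps (sort s) a) : a = sort s := by
  induction h with
  | refl => rfl
  | tail _ h ih => subst ih; cases h

theorem Steps.pi_inv {A B c : Expr} (h : Steps (Expr.pi A B) c) :
    ∃ A' B', c = Expr.pi A' B' ∧ Steps A A' ∧ Steps B B' := by
  induction h with
  | refl => exact ⟨A, B, rfl, .refl _, .refl _⟩
  | tail _ h ih =>
    obtain ⟨A', B', rfl, hA, hB⟩ := ih
    cases h with
    | pi1 _ h => exact ⟨_, _, rfl, hA.tail h, hB⟩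
    | pi2 _ h => exact ⟨_, _, rfl, hA, hB.tail h⟩

theorem Conv.steps_sort {a : Expr} {s : Srt} (h : Conv a (sort s)) : Steps a (sort s) := by
  obtain ⟨c, h1, h2⟩ := h.join
  rwa [h2.sort_eq] at h1

theorem Conv.sort_inj {s t : Srt} (h : Conv (sort s) (sort t)) : s = t := by
  simpa using h.steps_sort.sort_eq.symm

theorem Conv.pi_inj {A B A' B' : Expr} (h : Conv (Expr.pi A B) (Expr.pi A' B')) :
    Conv A A' ∧ Conv B B' := by
  obtain ⟨c, h1, h2⟩ := h.join
  obtain ⟨C, D, rfl, hA, hB⟩ := h1.pi_inv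
  obtain ⟨C', D', h, hA', hB'⟩ := h2.pi_inv
  cases h
  exact ⟨hA.conv.trans hA'.conv.symm, hB.conv.trans hB'.conv.symm⟩

/-! ### Metatheory of pure type systems -/

section Metatheory

variable {R : Set (Srt × Srt × Srt)}

/-- Induction on typing derivations alone, well-formed contexts being treated as side conditions. -/
theorem Typing.induct {motive : ∀ Γ a A, Typing R Γ a A → Prop}
    (sort : ∀ {Γ s₁ s₂} (h : WfCtx R Γ) (hs : Ax s₁ s₂), motive Γ (.sort s₁) (.sort s₂) (.sort h hs))
    (var : ∀ {Γ : Ctx} {n : ℕ} {A : Expr} (h : WfCtx R Γ) (hA : Γ[n]? = some A),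
      motive Γ (.var n) (A.rename (fun k => k + (n + 1))) (.var h hA))
    (pi : ∀ {Γ A B s₁ s₂ s₃} (hA : Typing R Γ A (.sort s₁))
      (hB : Typing R (A :: Γ) B (.sort s₂)) (hR : (s₁, s₂, s₃) ∈ R), motive Γ A (.sort s₁) hA →
      motive (A :: Γ) B (.sort s₂) hB → motive Γ (.pi A B) (.sort s₃) (.pi hA hB hR))
    (lam : ∀ {Γ A B b s} (hP : Typing R Γ (.pi A B) (.sort s)) (hb : Typing R (A :: Γ) b B),
      motive Γ (.pi A B) (.sort s) hP → motive (A :: Γ) b B hb →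
      motive Γ (.lam A b) (.pi A B) (.lam hP hb))
    (app : ∀ {Γ A B a b} (ha : Typing R Γ a (.pi A B)) (hb : Typing R Γ b A),
      motive Γ a (.pi A B) ha → motive Γ b A hb → motive Γ (.app a b) (B.inst b) (.app ha hb))
    (conv : ∀ {Γ A B a s} (ha : Typing R Γ a A) (hB : Typing R Γ B (.sort s)) (hc : Conv A B),
      motive Γ a A ha → motive Γ B (.sort s) hB → motive Γ a B (.conv ha hB hc))
    {Γ : Ctx} {a A : Expr} (h : Typing R Γ a A) : motive Γ a A h := by
  refine Typing.rec (motive_1 := motive) (motive_2 := fun _ _ => True)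
    ?_ ?_ ?_ ?_ ?_ ?_ trivial (fun _ _ => trivial) h
  · intro _ _ _ h h' _; exact sort h h'
  · intro _ _ _ h h' _; exact var h h'
  · intro _ _ _ _ _ _ h h' h'' ih ih'; exact pi h h' h'' ih ih'
  · intro _ _ _ _ _ h h' ih ih'; exact lam h h' ih ih'
  · intro _ _ _ _ _ h h' ih ih'; exact app h h' ih ih'
  · intro _ _ _ _ _ h h' h'' ih ih'; exact conv h h' h'' ih ih'

theorem Typing.wf {Γ : Ctx} {a A : Expr} (h : Typing R Γ a A) : WfCtx R Γ := by
  induction h using Typing.induct with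
  | sort h _ => exact h
  | var h _ => exact h
  | pi _ _ _ ih _ => exact ih
  | lam _ _ ih _ => exact ih
  | app _ _ ih _ => exact ih
  | conv _ _ _ ih _ => exact ih

theorem Typing.mono {R' : Set (Srt × Srt × Srt)} (hR : R ⊆ R') {Γ : Ctx} {a A : Expr}
    (h : Typing R Γ a A) : Typing R' Γ a A := by
  refine Typing.rec (motive_1 := fun Γ a A _ => Typing R' Γ a A)
    (motive_2 := fun Γ _ => WfCtx R' Γ) ?_ ?_ ?_ ?_ ?_ ?_ .nil (fun _ h => .cons h) h
  · intro _ _ _ _ h h'; exact .sort h' h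
  · intro _ _ _ _ h h'; exact .var h' h
  · intro _ _ _ _ _ _ _ _ h ih ih'; exact .pi ih ih' (hR h)
  · intro _ _ _ _ _ _ _ ih ih'; exact .lam ih ih'
  · intro _ _ _ _ _ _ _ ih ih'; exact .app ih ih'
  · intro _ _ _ _ _ _ _ h ih ih'; exact .conv ih ih' h

-- Inversion of typing derivations

theorem Typing.pi_inv {Γ : Ctx} {A B T : Expr} (h : Typing R Γ (.pi A B) T) :
    ∃ s₁ s₂ s₃, Typing R Γ A (.sort s₁) ∧ Typing R (A :: Γ) B (.sort s₂) ∧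
      (s₁, s₂, s₃) ∈ R ∧ Conv T (.sort s₃) := by
  generalize he : Expr.pi A B = e at h
  induction h using Typing.induct with
  | pi hA hB hR => cases he; exact ⟨_, _, _, hA, hB, hR, .refl _⟩
  | conv _ _ hc ih _ =>
    obtain ⟨s₁, s₂, s₃, hA, hB, hR, h⟩ := ih he
    exact ⟨s₁, s₂, s₃, hA, hB, hR, hc.symm.trans h⟩
  | sort | var | lam | app => cases he

theorem Typing.lam_inv {Γ : Ctx} {A b T : Expr} (h : Typing R Γ (.lam A b) T) :
    ∃ B s, Typing R Γ (.pi A B) (.sort s) ∧ Typing R (A :: Γ) b B ∧ Conv T (.pi A B) := by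
  generalize he : Expr.lam A b = e at h
  induction h using Typing.induct with
  | lam hA hB => cases he; exact ⟨_, _, hA, hB, .refl _⟩
  | conv _ _ hc ih _ =>
    obtain ⟨B, s, hA, hB, h⟩ := ih he
    exact ⟨B, s, hA, hB, hc.symm.trans h⟩
  | sort | var | pi | app => cases he

theorem Typing.app_inv {Γ : Ctx} {a b T : Expr} (h : Typing R Γ (.app a b) T) :
    ∃ A B, Typing R Γ a (.pi A B) ∧ Typing R Γ b A ∧ Conv T (B.inst b) := by
  generalize he : Expr.app a b = e at h
  induction h using Typing.induct with
  | app hA hB => cases he; exact ⟨_, _, hA, hB, .refl _⟩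
  | conv _ _ hc ih _ =>
    obtain ⟨A, B, hA, hB, h⟩ := ih he
    exact ⟨A, B, hA, hB, hc.symm.trans h⟩
  | sort | var | pi | lam => cases he

theorem Typing.var_inv {Γ : Ctx} {n : ℕ} {T : Expr} (h : Typing R Γ (.var n) T) :
    ∃ A, Γ[n]? = some A ∧ Conv T (A.rename (fun k => k + (n + 1))) := by
  generalize he : Expr.var n = e at h
  induction h using Typing.induct with
  | var _ hA => cases he; exact ⟨_, hA, .refl _⟩
  | conv _ _ hc ih _ =>
    obtain ⟨A, hA, h⟩ := ih he
    exact ⟨A, hA, hc.symm.trans h⟩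
  | sort | app | pi | lam => cases he

theorem Typing.sort_inv {Γ : Ctx} {s : Srt} {T : Expr} (h : Typing R Γ (.sort s) T) :
    ∃ s', Ax s s' ∧ Conv T (.sort s') := by
  generalize he : Expr.sort s = e at h
  induction h using Typing.induct with
  | sort _ hA => cases he; exact ⟨_, hA, .refl _⟩
  | conv _ _ hc ih _ =>
    obtain ⟨A, hA, h⟩ := ih he
    exact ⟨A, hA, hc.symm.trans h⟩
  | var | app | pi | lam => cases he

theorem not_typing_box {Γ : Ctx} {T : Expr} : ¬ Typing R Γ (.sort .box) T := by
  intro h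
  obtain ⟨_, h, _⟩ := h.sort_inv
  cases h

-- Renaming and substitution in typing derivations

theorem Typing.rename {Γ : Ctx} {a A : Expr} (h : Typing R Γ a A) {Δ : Ctx} {ξ : ℕ → ℕ}
    (hΔ : WfCtx R Δ)
    (hξ : ∀ n A, Γ[n]? = some A → ∃ A', Δ[ξ n]? = some A' ∧
      A'.rename (fun k => k + (ξ n + 1)) = (A.rename (fun k => k + (n + 1))).rename ξ) :
    Typing R Δ (a.rename ξ) (A.rename ξ) := by
  -- The compatibility condition on the renaming survives a binder, as the induction needs.
  have up {Γ Δ : Ctx} {ξ : ℕ → ℕ} (A : Expr)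
      (hξ : ∀ n A, Γ[n]? = some A → ∃ A', Δ[ξ n]? = some A' ∧
        A'.rename (fun k => k + (ξ n + 1)) = (A.rename (fun k => k + (n + 1))).rename ξ) :
      ∀ n B, (A :: Γ)[n]? = some B → ∃ B', (A.rename ξ :: Δ)[upr ξ n]? = some B' ∧
        B'.rename (fun k => k + (upr ξ n + 1)) =
          (B.rename (fun k => k + (n + 1))).rename (upr ξ) := by
    intro n B hB
    cases n with
    | zero =>
      simp only [List.getElem?_cons_zero, Option.some.injEq] at hB
      subst hB
      exact ⟨_, rfl, by simp [rename_rename, upr]⟩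
    | succ n =>
      obtain ⟨B', h1, h2⟩ := hξ n B (by simpa using hB)
      refine ⟨B', by simpa [upr] using h1, ?_⟩
      have := congrArg lift h2
      simp only [lift, rename_rename] at this
      simpa only [rename_rename, upr, Nat.add_assoc, Nat.add_eq] using this
  induction h using Typing.induct generalizing Δ ξ with
  | sort _ h => exact .sort hΔ h
  | var _ h =>
    obtain ⟨A', h1, h2⟩ := hξ _ _ h
    rw [← h2]
    exact .var hΔ h1
  | pi _ _ h ihA ihB =>
    have hA := ihA hΔ hξ
    exact .pi hA (ihB (.cons hA) (up _ hξ)) h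
  | lam _ _ ihP ihb =>
    have hP := ihP hΔ hξ
    obtain ⟨s₁, _, _, hA, _⟩ := hP.pi_inv
    exact .lam hP (ihb (.cons hA) (up _ hξ))
  | app _ _ iha ihb =>
    rw [rename_inst]
    exact .app (iha hΔ hξ) (ihb hΔ hξ)
  | conv _ _ hc iha ihB => exact .conv (iha hΔ hξ) (ihB hΔ hξ) (hc.rename ξ)

theorem Typing.lift {Γ : Ctx} {a A B : Expr} (h : Typing R Γ a A) (hΓ : WfCtx R (B :: Γ)) :
    Typing R (B :: Γ) a.lift A.lift :=
  h.rename hΓ fun n A hA => ⟨A, by simpa using hA, by simp [rename_rename, Nat.add_assoc]⟩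

/-- `σ` substitutes expressions over `Δ` of the right types for the variables of `Γ`. -/
def TypedSubst (R : Set (Srt × Srt × Srt)) (Γ Δ : Ctx) (σ : ℕ → Expr) : Prop :=
  ∀ n A, Γ[n]? = some A → Typing R Δ (σ n) ((A.rename (fun k => k + (n + 1))).subst σ)

theorem TypedSubst.ups {Γ Δ : Ctx} {σ : ℕ → Expr} (h : TypedSubst R Γ Δ σ) {A : Expr}
    (hΔ : WfCtx R (A.subst σ :: Δ)) : TypedSubst R (A :: Γ) (A.subst σ :: Δ) (ups σ) := by
  intro n B hB
  cases n with
  | zero =>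
    simp only [List.getElem?_cons_zero, Option.some.injEq] at hB
    subst hB
    have := Typing.var hΔ (n := 0) rfl
    rw [show Expr.rename (fun k => k + (0 + 1)) A = A.lift from rfl, subst_ups_lift]
    exact this
  | succ n =>
    have := (h n B (by simpa using hB)).lift hΔ
    rw [lift_subst, Expr.lift, Expr.lift, rename_rename] at this
    exact this

theorem Typing.subst {Γ : Ctx} {a A : Expr} (h : Typing R Γ a A) {Δ : Ctx} {σ : ℕ → Expr}
    (hΔ : WfCtx R Δ) (hσ : TypedSubst R Γ Δ σ) : Typing R Δ (a.subst σ) (A.subst σ) := by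
  induction h using Typing.induct generalizing Δ σ with
  | sort _ h => exact .sort hΔ h
  | var _ h => exact hσ _ _ h
  | pi _ _ h ihA ihB =>
    have hA := ihA hΔ hσ
    exact .pi hA (ihB (.cons hA) (hσ.ups (.cons hA))) h
  | lam _ _ ihP ihb =>
    have hP := ihP hΔ hσ
    obtain ⟨s₁, _, _, hA, _⟩ := hP.pi_inv
    exact .lam hP (ihb (.cons hA) (hσ.ups (.cons hA)))
  | app _ _ iha ihb =>
    rw [subst_inst]
    exact .app (iha hΔ hσ) (ihb hΔ hσ)
  | conv _ _ hc iha ihB => exact .conv (iha hΔ hσ) (ihB hΔ hσ) (hc.subst σ)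

theorem WfCtx.tail {Γ : Ctx} {A : Expr} (h : WfCtx R (A :: Γ)) : WfCtx R Γ := by
  cases h with
  | cons h => exact h.wf

theorem Typing.inst {Γ : Ctx} {a b A B : Expr} (h : Typing R (A :: Γ) b B)
    (ha : Typing R Γ a A) : Typing R Γ (b.inst a) (B.inst a) := by
  refine h.subst ha.wf fun n C hC => ?_
  cases n with
  | zero =>
    simp only [List.getElem?_cons_zero, Option.some.injEq] at hC
    subst hC
    exact (subst_single_lift A a).symm ▸ ha
  | succ n =>
    rw [subst_rename]
    have := Typing.var (R := R) ha.wf (n := n) (A := C) (by simpa using hC)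
    rw [rename_eq_subst] at this
    exact this

theorem WfCtx.typing_of_mem {Γ : Ctx} (h : WfCtx R Γ) {n : ℕ} {A : Expr} (hA : Γ[n]? = some A) :
    ∃ s, Typing R Γ (A.rename (fun k => k + (n + 1))) (.sort s) := by
  induction Γ generalizing n with
  | nil => simp at hA
  | cons B Γ ih =>
    cases n with
    | zero =>
      simp only [List.getElem?_cons_zero, Option.some.injEq] at hA
      subst hA
      cases h with
      | cons hB => exact ⟨_, hB.lift (.cons hB)⟩
    | succ n =>
      obtain ⟨s, hs⟩ := ih h.tail (by simpa using hA)
      have := hs.lift h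
      rw [Expr.lift, rename_rename] at this
      exact ⟨s, this⟩

/-- The first alternative cannot be dropped: a type may be `□`, which is itself untypable. -/
theorem Typing.correct {Γ : Ctx} {a A : Expr} (h : Typing R Γ a A) :
    (∃ s, A = .sort s) ∨ ∃ s, Typing R Γ A (.sort s) := by
  induction h using Typing.induct with
  | sort => exact .inl ⟨_, rfl⟩
  | var h hA => exact .inr (h.typing_of_mem hA)
  | pi => exact .inl ⟨_, rfl⟩
  | lam h => exact .inr ⟨_, h⟩
  | app _ hb iha _ =>
    rcases iha with ⟨_, h⟩ | ⟨s, h⟩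
    · cases h
    · obtain ⟨_, s, _, _, hB, _⟩ := h.pi_inv
      exact .inr ⟨s, hB.inst hb⟩
  | conv _ h => exact .inr ⟨_, h⟩

theorem Typing.pi_correct {Γ : Ctx} {a A B : Expr} (h : Typing R Γ a (.pi A B)) :
    ∃ s₁ s₂ s₃, Typing R Γ A (.sort s₁) ∧ Typing R (A :: Γ) B (.sort s₂) ∧
      (s₁, s₂, s₃) ∈ R ∧ Typing R Γ (.pi A B) (.sort s₃) := by
  rcases h.correct with ⟨_, h⟩ | ⟨s, h⟩
  · cases h
  · obtain ⟨s₁, s₂, s₃, hA, hB, hR, _⟩ := h.pi_inv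
    exact ⟨s₁, s₂, s₃, hA, hB, hR, .pi hA hB hR⟩

/-- The identity is a well-typed substitution between the two contexts; only the variable `0` needs
the conversion rule. -/
theorem Typing.conv_head {Γ : Ctx} {a A B B' : Expr} {s : Srt} (h : Typing R (B :: Γ) a A)
    (hB' : Typing R Γ B' (.sort s)) (hc : Conv B' B) : Typing R (B' :: Γ) a A := by
  have hw : WfCtx R (B' :: Γ) := .cons hB'
  have := h.subst hw (σ := Expr.var) fun n C hC => by
    rw [subst_var]
    cases n with
    | zero =>
      simp only [List.getElem?_cons_zero, Option.some.injEq] at hC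
      subst hC
      cases h.wf with
      | cons hB => exact .conv (.var hw rfl) (hB.lift hw) (hc.rename _)
    | succ n => exact .var hw (by simpa using hC)
  simpa only [subst_var] using this

/-- Subject reduction. -/
theorem Typing.step {Γ : Ctx} {a A a' : Expr} (h : Typing R Γ a A) (hs : Step a a') :
    Typing R Γ a' A := by
  induction h using Typing.induct generalizing a' with
  | sort | var => cases hs
  | pi hA hB hR ihA ihB =>
    cases hs with
    | pi1 _ hs => exact .pi (ihA hs) (hB.conv_head (ihA hs) hs.conv.symm) hR
    | pi2 _ hs => exact .pi hA (ihB hs) hR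
  | lam hP hb ihP ihb =>
    cases hs with
    | lam1 _ hs =>
      have hP' := ihP (.pi1 _ hs)
      obtain ⟨_, _, _, hA, _⟩ := hP'.pi_inv
      -- The reduced annotation changes the product that types the abstraction, so conversion
      -- restores the original one.
      exact .conv (.lam hP' (hb.conv_head hA hs.conv.symm)) hP (Step.pi1 _ hs).conv.symm
    | lam2 _ hs => exact .lam hP (ihb hs)
  | @app Γ A B a b ha hb iha ihb =>
    obtain ⟨_, _, _, hA, hB, _⟩ := ha.pi_correct
    cases hs with
    | beta A' c _ =>
      obtain ⟨B', s, hP, hc, hconv⟩ := ha.lam_inv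
      -- The annotation `A'` need only be convertible to the domain `A`. Injectivity of products
      -- moves the argument to `A'` and the type of the body back to `B`.
      obtain ⟨h1, h2⟩ := hconv.pi_inj
      obtain ⟨_, _, _, hA', _⟩ := hP.pi_inv
      exact .conv (hc.inst (.conv hb hA' h1)) (hB.inst hb) (h2.symm.subst _)
    | app1 _ hs => exact .app (iha hs) hb
    | app2 _ hs =>
      exact .conv (.app ha (ihb hs)) (hB.inst hb)
        (Steps.inst_right B (Relation.ReflTransGen.single hs)).conv.symm
  | conv _ hB hc iha _ => exact .conv (iha hs) hB hc

theorem Typing.steps {Γ : Ctx} {a A a' : Expr} (h : Typing R Γ a A) (hs : Steps a a') :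
    Typing R Γ a' A := by
  induction hs with
  | refl => exact h
  | tail _ hs ih => exact ih.step hs

/-- By confluence such an expression would reduce to `□`, and subject reduction would then type `□`.
-/
theorem Typing.not_conv_box {Γ : Ctx} {a A : Expr} (h : Typing R Γ a A) :
    ¬ Conv a (.sort .box) :=
  fun hc => not_typing_box (h.steps hc.steps_sort)

/-- The third sort of a product rule is determined by the first two, as in all our systems. -/
def Functional (R : Set (Srt × Srt × Srt)) : Prop :=
  ∀ s₁ s₂ s₃ s₃', (s₁, s₂, s₃) ∈ R → (s₁, s₂, s₃') ∈ R → s₃ = s₃'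

theorem Typing.unique (hF : Functional R) {Γ : Ctx} {a A A' : Expr} (h : Typing R Γ a A)
    (h' : Typing R Γ a A') : Conv A A' := by
  induction h using Typing.induct generalizing A' with
  | sort _ hs =>
    obtain ⟨_, hs', hc⟩ := h'.sort_inv
    cases hs; cases hs'; exact hc.symm
  | var _ hA =>
    obtain ⟨_, hA', hc⟩ := h'.var_inv
    cases hA.symm.trans hA'
    exact hc.symm
  | pi _ _ hR ihA ihB =>
    obtain ⟨_, _, _, hA, hB, hR', hc⟩ := h'.pi_inv
    cases (ihA hA).sort_inj
    cases (ihB hB).sort_inj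
    cases hF _ _ _ _ hR hR'
    exact hc.symm
  | lam _ _ _ ihb =>
    obtain ⟨_, _, _, hb, hc⟩ := h'.lam_inv
    exact ((ihb hb).map fun _ _ => Step.pi2 _).trans hc.symm
  | app _ _ iha _ =>
    obtain ⟨_, _, ha, _, hc⟩ := h'.app_inv
    exact ((iha ha).pi_inj.2.subst _).trans hc.symm
  | conv _ _ hc iha _ => exact hc.symm.trans (iha h')

end Metatheory

/-! ### Classification in the calculus of constructions -/

/-- This is why classification can ignore domains: a product lies in the sort of its codomain, so
`isK` follows codomains and `isT` follows bodies and function parts. -/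
theorem mem_rulesCC {s₁ s₂ s₃ : Srt} : (s₁, s₂, s₃) ∈ rulesCC ↔ s₃ = s₂ := by
  cases s₁ <;> cases s₂ <;> cases s₃ <;> simp [rulesCC]

theorem functional_rulesCC : Functional rulesCC := by
  intro _ _ _ _ h h'
  rw [mem_rulesCC] at h h'
  exact h.trans h'.symm

theorem rulesFω_subset : rulesFω ⊆ rulesCC := by
  intro x hx
  simp only [rulesFω, rulesCC, Set.mem_insert_iff, Set.mem_singleton_iff] at *
  tauto

theorem IsKind.mono {R R' : Set (Srt × Srt × Srt)} (hR : R ⊆ R') {A : Expr} (h : IsKind R A) :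
    IsKind R' A :=
  h.imp fun _ h => h.mono hR

namespace Expr

/-- The expressions of the shape of a kind: iterated products that end in a sort. -/
def isK : Expr → Bool
  | sort _ => true
  | pi _ B => isK B
  | _ => false

/-- Extension of a classification of the variables by one variable. -/
def ext (b : Bool) (δ : ℕ → Bool) : ℕ → Bool
  | 0 => b
  | n + 1 => δ n

/-- The expressions of the shape of a term, `δ` telling which variables are terms. -/
def isT : (ℕ → Bool) → Expr → Bool
  | _, sort _ => false
  | δ, var n => δ n
  | _, pi _ _ => false
  | δ, lam A b => isT (ext (!isK A) δ) b
  | δ, app a _ => isT δ a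

/-- No term stands where a type or kind is expected. -/
def Stratified : (ℕ → Bool) → Expr → Prop
  | _, sort _ => True
  | _, var _ => True
  | δ, pi A B => isT δ A = false ∧ Stratified δ A ∧ isT (ext (!isK A) δ) B = false ∧
      Stratified (ext (!isK A) δ) B
  | δ, lam A b => isT δ A = false ∧ Stratified δ A ∧ Stratified (ext (!isK A) δ) b
  | δ, app a b => Stratified δ a ∧ Stratified δ b

theorem isK_rename (ξ : ℕ → ℕ) (a : Expr) : isK (rename ξ a) = isK a := by
  induction a generalizing ξ <;> simp_all [rename, isK]

theorem isK_ups {σ : ℕ → Expr} (h : ∀ n, isK (σ n) = false) (n : ℕ) : isK (ups σ n) = false := by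
  cases n
  · rfl
  · exact (isK_rename _ _).trans (h _)

/-- The hypothesis keeps a variable at the end of a product from becoming a sort. In a typable redex
it holds for the argument, whose type is itself typable. -/
theorem isK_subst {σ : ℕ → Expr} (h : ∀ n, isK (σ n) = false) (a : Expr) :
    isK (subst σ a) = isK a := by
  induction a generalizing σ with
  | var n => exact h n
  | pi A B _ ihB => exact ihB (isK_ups h)
  | sort | lam | app => rfl

theorem ext_upr {δ δ' : ℕ → Bool} {ξ : ℕ → ℕ} (h : ∀ n, δ' (ξ n) = δ n) (b : Bool) (n : ℕ) :
    ext b δ' (upr ξ n) = ext b δ n := by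
  cases n
  · rfl
  · exact h _

theorem isT_rename {δ δ' : ℕ → Bool} {ξ : ℕ → ℕ} (h : ∀ n, δ' (ξ n) = δ n) (a : Expr) :
    isT δ' (rename ξ a) = isT δ a := by
  induction a generalizing δ δ' ξ with
  | var n => exact h n
  | sort | pi => rfl
  | lam A b _ ih => simpa only [rename, isT, isK_rename] using ih (ext_upr h _)
  | app a b ih _ => exact ih h

theorem isT_ups {δ δ' : ℕ → Bool} {σ : ℕ → Expr} (h : ∀ n, isT δ' (σ n) = δ n) (b : Bool)
    (n : ℕ) : isT (ext b δ') (ups σ n) = ext b δ n := by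
  cases n with
  | zero => rfl
  | succ n => exact (isT_rename (fun _ => rfl) _).trans (h n)

theorem isT_subst {δ δ' : ℕ → Bool} {σ : ℕ → Expr} (hK : ∀ n, isK (σ n) = false)
    (h : ∀ n, isT δ' (σ n) = δ n) (a : Expr) : isT δ' (subst σ a) = isT δ a := by
  induction a generalizing δ δ' σ with
  | var n => exact h n
  | sort | pi => rfl
  | lam A b _ ih => simpa only [subst, isT, isK_subst hK] using ih (isK_ups hK) (isT_ups h _)
  | app a b ih _ => exact ih hK h

theorem Stratified.rename {δ δ' : ℕ → Bool} {ξ : ℕ → ℕ} (h : ∀ n, δ' (ξ n) = δ n) {a : Expr}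
    (ha : Stratified δ a) : Stratified δ' (rename ξ a) := by
  induction a generalizing δ δ' ξ with
  | var | sort => trivial
  | pi A B ihA ihB =>
    obtain ⟨h1, h2, h3, h4⟩ := ha
    simp only [Expr.rename, Stratified, isK_rename]
    exact ⟨(isT_rename h A).trans h1, ihA h h2, (isT_rename (ext_upr h _) B).trans h3,
      ihB (ext_upr h _) h4⟩
  | lam A b ihA ihb =>
    obtain ⟨h1, h2, h3⟩ := ha
    simp only [Expr.rename, Stratified, isK_rename]
    exact ⟨(isT_rename h A).trans h1, ihA h h2, ihb (ext_upr h _) h3⟩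
  | app a b iha ihb => exact ⟨iha h ha.1, ihb h ha.2⟩

end Expr

/-- The classification of the variables of a context: those with a kind as type are constructors,
the others are terms. -/
def termVars : Ctx → ℕ → Bool
  | [] => fun _ => false
  | A :: Γ => ext (!isK A) (termVars Γ)

theorem termVars_eq {Γ : Ctx} {n : ℕ} {A : Expr} (h : Γ[n]? = some A) :
    termVars Γ n = !isK A := by
  induction Γ generalizing n with
  | nil => simp at h
  | cons B Γ ih =>
    cases n with
    | zero => simp at h; simp [termVars, ext, h]
    | succ n => exact ih (by simpa using h)

/-- Products inherit the sort of their codomain. Variables and applications have typable types and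
abstractions have products as types, so none has type `□`. Conversion can neither leave nor reach
`□`, because its target must be typable and no typable expression is convertible to `□`; hence a
literal equality on the right. -/
theorem Typing.isK_iff {Γ : Ctx} {a A : Expr} (h : Typing rulesCC Γ a A) :
    isK a = true ↔ A = .sort .box := by
  induction h using Typing.induct with
  | sort _ hs => cases hs; simp [isK]
  | var hΓ hA =>
    simp only [isK, Bool.false_eq_true, false_iff]
    intro h
    obtain ⟨s, hs⟩ := hΓ.typing_of_mem hA
    exact not_typing_box (h ▸ hs)
  | pi hA hB hR _ ihB =>
    rw [mem_rulesCC] at hR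
    subst hR
    exact ihB
  | lam => simp [isK]
  | app ha hb =>
    simp only [isK, Bool.false_eq_true, false_iff]
    intro h
    obtain ⟨_, _, _, _, hB, _⟩ := ha.pi_correct
    have := hB.inst hb
    exact not_typing_box (h ▸ this)
  | conv ha hB hc iha _ =>
    rw [iha]
    constructor
    · rintro rfl
      exact absurd hc.symm hB.not_conv_box
    · rintro rfl
      exact absurd hB not_typing_box

theorem Typing.sort_unique {Γ : Ctx} {A B : Expr} {s t : Srt} (hA : Typing rulesCC Γ A (.sort s))
    (hB : Typing rulesCC Γ B (.sort t)) (hc : Conv A B) : s = t := by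
  obtain ⟨c, h1, h2⟩ := hc.join
  exact ((hA.steps h1).unique functional_rulesCC (hB.steps h2)).sort_inj

theorem Typing.star_iff {Γ : Ctx} {A : Expr} {s : Srt} (hA : Typing rulesCC Γ A (.sort s)) :
    Typing rulesCC Γ A (.sort .star) ↔ s = .star :=
  ⟨fun h => hA.sort_unique h (.refl _), fun h => h ▸ hA⟩

theorem not_typing_sort_star {Γ : Ctx} {s : Srt} :
    ¬ Typing rulesCC Γ (.sort s) (.sort .star) := by
  intro h
  obtain ⟨_, hs, hc⟩ := h.sort_inv
  cases hs
  cases hc.sort_inj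

/-- The sort of the type is what is being tracked. It passes from a body to its abstraction and from
a function to its application because a product has the sort of its codomain, and it is invariant
under conversion of typable types. -/
theorem Typing.isT_iff {Γ : Ctx} {a A : Expr} (h : Typing rulesCC Γ a A) :
    isT (termVars Γ) a = true ↔ Typing rulesCC Γ A (.sort .star) := by
  induction h using Typing.induct with
  | sort | pi => simp [isT, not_typing_sort_star]
  | @var Γ n A hΓ hA =>
    obtain ⟨s, hs⟩ := hΓ.typing_of_mem hA
    rw [hs.star_iff, isT, termVars_eq hA, ← isK_rename (fun k => k + (n + 1)) A]
    have := hs.isK_iff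
    cases s <;> simp_all
  | lam hP hb _ ihb =>
    obtain ⟨_, _, _, hA, hB, hR, hc⟩ := hP.pi_inv
    rw [mem_rulesCC] at hR
    rw [hP.star_iff, isT]
    cases hc.sort_inj
    rw [hR]
    exact ihb.trans hB.star_iff
  | app ha hb iha _ =>
    obtain ⟨_, _, _, hA, hB, hR, hP⟩ := ha.pi_correct
    rw [mem_rulesCC] at hR
    subst hR
    rw [(show Typing _ _ _ (.sort _) from hB.inst hb).star_iff, ← hP.star_iff]
    exact iha
  | conv ha hB hc iha _ =>
    rw [iha, hB.star_iff]
    -- If the old type is a sort, the new type `B` cannot lie in `∗`: it is not convertible to `□`,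
    -- and if it reduced to `∗`, subject reduction would give `∗ : ∗`.
    rcases ha.correct with ⟨s, rfl⟩ | ⟨s, hs⟩
    · refine iff_of_false not_typing_sort_star ?_
      rintro rfl
      cases s with
      | box => exact hB.not_conv_box hc.symm
      | star =>
        obtain ⟨_, h, hc'⟩ := (hB.steps hc.symm.steps_sort).sort_inv
        cases h
        cases hc'.sort_inj
    · rw [hs.star_iff, hs.sort_unique hB hc]

theorem Typing.isT_of_sort {Γ : Ctx} {A : Expr} {s : Srt} (h : Typing rulesCC Γ A (.sort s)) :
    isT (termVars Γ) A = false := by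
  rw [Bool.eq_false_iff, ne_eq, h.isT_iff]
  exact not_typing_sort_star

theorem Typing.stratified {Γ : Ctx} {a A : Expr} (h : Typing rulesCC Γ a A) :
    Stratified (termVars Γ) a := by
  induction h using Typing.induct with
  | sort | var => trivial
  | pi hA hB _ ihA ihB => exact ⟨hA.isT_of_sort, ihA, hB.isT_of_sort, ihB⟩
  | lam hP _ ihP ihb => exact ⟨ihP.1, ihP.2.1, ihb⟩
  | app _ _ iha ihb => exact ⟨iha, ihb⟩
  | conv _ _ _ iha _ => exact iha

theorem Typing.isK_eq_false {Γ : Ctx} {a A T : Expr} (h : Typing rulesCC Γ a A)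
    (hA : Typing rulesCC Γ A T) : isK a = false := by
  rw [Bool.eq_false_iff, ne_eq, h.isK_iff]
  rintro rfl
  exact not_typing_box hA

theorem Typing.isT_eq {Γ : Ctx} {a A : Expr} {s : Srt} (h : Typing rulesCC Γ a A)
    (hA : Typing rulesCC Γ A (.sort s)) : isT (termVars Γ) a = !isK A := by
  rw [Bool.eq_iff_iff, h.isT_iff, hA.star_iff, Bool.not_eq_true', Bool.eq_false_iff, ne_eq,
    hA.isK_iff]
  cases s <;> simp

/-- Subject reduction preserves the type, hence the class. With `isT_step` this ensures that an
expression and its reduct fall under the same clause of the translations. -/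
theorem Typing.isK_step {Γ : Ctx} {a a' A : Expr} (h : Typing rulesCC Γ a A) (hs : Step a a') :
    isK a' = isK a := by
  rw [Bool.eq_iff_iff, h.isK_iff, (h.step hs).isK_iff]

theorem Typing.isT_step {Γ : Ctx} {a a' A : Expr} (h : Typing rulesCC Γ a A) (hs : Step a a') :
    isT (termVars Γ) a' = isT (termVars Γ) a := by
  rw [Bool.eq_iff_iff, h.isT_iff, (h.step hs).isT_iff]

theorem IsKind.isK {A : Expr} (h : IsKind rulesCC A) : isK A = true := by
  obtain ⟨_, h⟩ := h
  exact h.isK_iff.2 rfl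

theorem Typing.isKind_iff {Γ : Ctx} {a A : Expr} (h : Typing rulesCC Γ a A) :
    IsKind rulesCC a ↔ isK a = true :=
  ⟨IsKind.isK, fun h' => ⟨Γ, h.isK_iff.1 h' ▸ h⟩⟩

/-- Being a constructor asks for some type in `□`; by uniqueness of types the given type `A`
decides. -/
theorem Typing.isConstructor_iff {Γ : Ctx} {a A : Expr} {s : Srt} (h : Typing rulesCC Γ a A)
    (hA : Typing rulesCC Γ A (.sort s)) :
    IsConstructor rulesCC Γ a ↔ isT (termVars Γ) a = false := by
  rw [h.isT_eq hA, Bool.not_eq_false', hA.isK_iff]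
  constructor
  · rintro ⟨B, hB, hs⟩
    rw [hA.sort_unique hs (h.unique functional_rulesCC hB)]
  · intro hs
    exact ⟨A, h, hs ▸ hA⟩

/-- The data on a typable `β`-redex that its contraction depends on. -/
theorem Typing.redex {Γ : Ctx} {A b a T : Expr} (h : Typing rulesCC Γ (.app (.lam A b) a) T) :
    isK a = false ∧ isT (termVars Γ) a = !isK A ∧ Stratified (termVars Γ) a ∧
      Stratified (ext (!isK A) (termVars Γ)) b := by
  obtain ⟨A', B', hl, ha, _⟩ := h.app_inv
  obtain ⟨B, s, hP, hb, hc⟩ := hl.lam_inv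
  obtain ⟨_, _, _, hA, _⟩ := hP.pi_inv
  have ha' := Typing.conv ha hA hc.pi_inj.1
  exact ⟨ha'.isK_eq_false hA, ha'.isT_eq hA, ha.stratified, hb.stratified⟩

/-! ### The translations, driven by the shapes of expressions -/

/-- The translation `V`, with kinds recognized by their shape. -/
def kindS : Expr → Expr
  | sort _ => sort .star
  | pi A B => if isK A then arrow (kindS A) (kindS B) else kindS B
  | _ => sort .star

/-- The type translation, with kinds and terms recognized by their shapes. -/
def typS : (ℕ → Bool) → Names → Expr → Expr
  | _, E, sort _ => var E.zero
  | _, E, var n => var (E.x n)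
  | δ, E, pi A B =>
      if isK A then
        pi (kindS A) (arrow (typS δ E A).lift (typS (ext (!isK A) δ) E.bind B))
      else pi (typS δ E A) (typS (ext (!isK A) δ) E.bind B)
  | δ, E, lam A B =>
      if isK A then lam (kindS A) (typS (ext (!isK A) δ) E.bind B)
      else typS (ext (!isK A) δ) E.erase B
  | δ, E, app A B => if isT δ B then typS δ E A else app (typS δ E A) (typS δ E B)

/-- The canonical constant `c^(0 → 0 → 0)` of the translation of products. -/
def prodConst (E : Names) : Expr :=
  app (var E.z) (arrow (var E.zero) (arrow (var E.zero) (var E.zero)))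

/-- The term translation, with kinds and terms recognized by their shapes. -/
noncomputable def trmS : (ℕ → Bool) → Names → Expr → Expr
  | _, E, sort _ => app (var E.z) (var E.zero)
  | δ, E, var n => if δ n then var (E.x n) else var (E.w n)
  | δ, E, pi A B =>
      if isK A then
        app (app (prodConst E) (trmS δ E A))
          (((trmS (ext (!isK A) δ) E.bindKind B).inst (app (var E.z) (typS δ E A)).lift).inst
            (canon E.zero E.z (kindS A)))
      else
        app (app (prodConst E) (trmS δ E A))
          ((trmS (ext (!isK A) δ) E.bind B).inst (app (var E.z) (typS δ E A)))
  | δ, E, lam A b =>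
      if isK A then
        app (lam (var E.zero) (lam (kindS A)
            (lam (typS δ E A).lift (trmS (ext (!isK A) δ) E.bindKind b))).lift) (trmS δ E A)
      else
        app (lam (var E.zero) (lam (typS δ E A) (trmS (ext (!isK A) δ) E.bind b)).lift)
          (trmS δ E A)
  | δ, E, app A B =>
      if isT δ B then app (trmS δ E A) (trmS δ E B)
      else app (app (trmS δ E A) (typS δ E B)) (trmS δ E B)

theorem canon_of_isK_eq_false {B : Expr} (h : isK B = false) (o z : ℕ) :
    canon o z B = app (var z) B := by
  cases B with
  | sort s => cases h
  | pi A B =>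
    rw [canon, if_neg]
    intro h'
    rw [(h'.mono rulesFω_subset).isK] at h
    cases h
  | var | lam | app => rfl

/-- Translated sorts become the variable `0`, so no sort is left at the end of a product. The
canonical inhabitant of a translated type is therefore always `z` applied to it. -/
theorem isK_typS (δ : ℕ → Bool) (E : Names) (a : Expr) : isK (typS δ E a) = false := by
  induction a generalizing δ E with
  | sort | var => rfl
  | pi A B _ ih =>
    rw [typS]
    split
    · simpa only [isK, arrow, lift, isK_rename] using ih _ _
    · exact ih _ _
  | lam A b _ ih =>
    rw [typS]
    split
    · rfl
    · exact ih _ _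
  | app a b ih _ =>
    rw [typS]
    split
    · exact ih _ _
    · rfl

theorem Typing.V_eq {Γ : Ctx} {A T : Expr} (h : Typing rulesCC Γ A T) : V A = kindS A := by
  induction A generalizing Γ T with
  | sort | var | lam | app => rfl
  | pi A B ihA ihB =>
    obtain ⟨_, _, _, hA, hB, _⟩ := h.pi_inv
    simp only [V, kindS, hA.isKind_iff, ihA hA, ihB hB]

/-- Inversion makes all immediate subexpressions typable, and there the tests by typability and by
shape agree. -/
theorem Typing.typAux_eq {Γ : Ctx} {a T : Expr} (h : Typing rulesCC Γ a T) (E : Names) :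
    typAux Γ E a = typS (termVars Γ) E a := by
  induction a generalizing Γ T E with
  | sort | var => rfl
  | pi A B ihA ihB =>
    obtain ⟨_, _, _, hA, hB, _⟩ := h.pi_inv
    simp only [typAux, typS, hA.isKind_iff, ihA hA, ihB hB, hA.V_eq, termVars]
  | lam A b ihA ihb =>
    obtain ⟨_, _, hP, hb, _⟩ := h.lam_inv
    obtain ⟨_, _, _, hA, _⟩ := hP.pi_inv
    simp only [typAux, typS, hA.isKind_iff, ihb hb, hA.V_eq, termVars]
  | app a b iha ihb =>
    obtain ⟨_, _, ha, hb, _⟩ := h.app_inv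
    obtain ⟨_, _, _, hA, _⟩ := ha.pi_correct
    simp only [typAux, typS, hb.isConstructor_iff hA, iha ha, ihb hb]
    cases isT (termVars Γ) b <;> rfl

theorem Typing.trmAux_eq {Γ : Ctx} {a T : Expr} (h : Typing rulesCC Γ a T) (E : Names) :
    trmAux Γ E a = trmS (termVars Γ) E a := by
  induction a generalizing Γ T E with
  | sort => rfl
  | var n =>
    obtain ⟨A, hA, _⟩ := h.var_inv
    obtain ⟨s, hs⟩ := h.wf.typing_of_mem hA
    simp only [trmAux, trmS, (Typing.var h.wf hA).isConstructor_iff hs, isT]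
    cases termVars Γ n <;> rfl
  | pi A B ihA ihB =>
    obtain ⟨_, _, _, hA, hB, _⟩ := h.pi_inv
    simp only [trmAux, trmS, hA.isKind_iff, ihA hA, ihB hB, hA.V_eq, termVars, hA.typAux_eq,
      canon_of_isK_eq_false (isK_typS _ _ _), prodConst]
    rw [canon_of_isK_eq_false (by rfl)]
  | lam A b ihA ihb =>
    obtain ⟨_, _, hP, hb, _⟩ := h.lam_inv
    obtain ⟨_, _, _, hA, _⟩ := hP.pi_inv
    simp only [trmAux, trmS, hA.isKind_iff, ihA hA, ihb hb, hA.V_eq, termVars, hA.typAux_eq]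
  | app a b iha ihb =>
    obtain ⟨_, _, ha, hb, _⟩ := h.app_inv
    obtain ⟨_, _, _, hA, _⟩ := ha.pi_correct
    simp only [trmAux, trmS, hb.isConstructor_iff hA, iha ha, ihb hb, hb.typAux_eq]
    cases isT (termVars Γ) b <;> rfl

/-! ### Translations and substitution -/

/-- Translated kinds are closed: they are built from `∗` and nondependent arrows. -/
theorem subst_kindS (σ : ℕ → Expr) (A : Expr) : subst σ (kindS A) = kindS A := by
  induction A with
  | sort | var | lam | app => rfl
  | pi A B ihA ihB =>
    rw [kindS]
    split
    · rw [subst_arrow, ihA, ihB]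
    · exact ihB

theorem rename_kindS (ρ : ℕ → ℕ) (A : Expr) : rename ρ (kindS A) = kindS A := by
  rw [rename_eq_subst, subst_kindS]

/-- The variables of a kind occur only in parts that `V` discards. The shape of a kind is needed: a
variable could be replaced by a product, on which `kindS` takes another value. -/
theorem kindS_subst {σ : ℕ → Expr} (h : ∀ n, isK (σ n) = false) {A : Expr} (hA : isK A = true) :
    kindS (subst σ A) = kindS A := by
  induction A generalizing σ with
  | sort => rfl
  | var | lam | app => cases hA
  | pi A B ihA ihB =>
    simp only [subst, kindS, isK_subst h, ihB (isK_ups h) hA]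
    split
    · rename_i h'; rw [ihA h h']
    · rfl

theorem kindS_rename (ρ : ℕ → ℕ) {A : Expr} (hA : isK A = true) :
    kindS (rename ρ A) = kindS A := by
  rw [rename_eq_subst, kindS_subst (fun _ => rfl) hA]

theorem subst_canon_kindS {τ : ℕ → Expr} {o z o' z' : ℕ} (ho : τ o = var o') (hz : τ z = var z')
    (A : Expr) : subst τ (canon o z (kindS A)) = canon o' z' (kindS A) := by
  induction A generalizing τ o z o' z' with
  | sort | var | lam | app => exact ho
  | pi A B ihA ihB =>
    rw [kindS]
    split
    · have hlift : lift (kindS B) = kindS B := rename_kindS _ _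
      rw [arrow, hlift, canon]
      -- Because translated kinds are closed, the test in `canon` concerns the same expression
      -- before and after substitution, so its outcome need not be determined.
      by_cases hc : IsKind rulesFω (pi (kindS A) (kindS B))
      · rw [if_pos hc, canon, if_pos hc, subst, subst_kindS, ihB (o' := o' + 1) (z' := z' + 1)]
        · simp [ups, ho, lift, rename]
        · simp [ups, hz, lift, rename]
      · have hB : subst (ups τ) (kindS B) = kindS B := subst_kindS _ _
        rw [if_neg hc, canon, if_neg hc, subst, subst, subst, subst_kindS, hB, hz]
    · exact ihB ho hz

theorem rename_canon_kindS (ρ : ℕ → ℕ) (o z : ℕ) (A : Expr) :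
    rename ρ (canon o z (kindS A)) = canon (ρ o) (ρ z) (kindS A) := by
  rw [rename_eq_subst]
  exact subst_canon_kindS (τ := fun n => var (ρ n)) rfl rfl A

/-- The source renaming `ξ` and the target renaming `ρ` agree as far as types are concerned. -/
structure TypRen (δ δ' : ℕ → Bool) (E E' : Names) (ξ ρ : ℕ → ℕ) : Prop where
  isT : ∀ n, δ' (ξ n) = δ n
  x : ∀ n, δ n = false → E'.x (ξ n) = ρ (E.x n)
  zero : E'.zero = ρ E.zero

theorem TypRen.bind {δ δ' : ℕ → Bool} {E E' : Names} {ξ ρ : ℕ → ℕ} (h : TypRen δ δ' E E' ξ ρ)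
    (b : Bool) : TypRen (ext b δ) (ext b δ') E.bind E'.bind (upr ξ) (upr ρ) where
  isT := ext_upr h.isT b
  x n hn := by
    cases n with
    | zero => rfl
    | succ n => exact congrArg (· + 1) (h.x n hn)
  zero := congrArg (· + 1) h.zero

/-- An erased binder extends the source renaming but not the target one. The dummy name of the
erased variable is harmless: it is marked as a term, and agreement is required on constructors only.
-/
theorem TypRen.erase {δ δ' : ℕ → Bool} {E E' : Names} {ξ ρ : ℕ → ℕ} (h : TypRen δ δ' E E' ξ ρ) :
    TypRen (ext true δ) (ext true δ') E.erase E'.erase (upr ξ) ρ where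
  isT := ext_upr h.isT true
  x n hn := by
    cases n with
    | zero => cases hn
    | succ n => exact h.x n hn
  zero := h.zero

theorem typS_rename {δ δ' : ℕ → Bool} {E E' : Names} {ξ ρ : ℕ → ℕ} (h : TypRen δ δ' E E' ξ ρ)
    {a : Expr} (ha : Stratified δ a) (ht : isT δ a = false) :
    typS δ' E' (rename ξ a) = rename ρ (typS δ E a) := by
  induction a generalizing δ δ' E E' ξ ρ with
  | sort => exact congrArg var h.zero
  | var n => exact congrArg var (h.x n ht)
  | pi A B ihA ihB =>
    obtain ⟨h1, h2, h3, h4⟩ := ha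
    simp only [rename, typS, isK_rename, ihA h h2 h1, ihB (h.bind _) h4 h3]
    split
    · rename_i hK
      simp only [rename, rename_arrow, rename_upr_lift, rename_kindS, kindS_rename _ hK]
    · rfl
  | lam A b _ ih =>
    obtain ⟨h1, h2, h3⟩ := ha
    simp only [rename, typS, isK_rename, ih (h.bind _) h3 ht]
    split
    · rename_i hK
      simp only [rename, rename_kindS, kindS_rename _ hK]
    · rename_i hK
      simp only [isT, Bool.eq_false_iff.2 hK, Bool.not_false] at h3 ht ⊢
      exact ih h.erase h3 ht
  | app a b iha ihb =>
    simp only [rename, typS, isT_rename h.isT, iha h ha.1 ht]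
    split
    · rfl
    · rename_i hb
      rw [ihb h ha.2 (Bool.eq_false_iff.2 hb), rename]

theorem typS_lift_bind {δ : ℕ → Bool} {a : Expr} (ha : Stratified δ a) (ht : isT δ a = false)
    (b : Bool) (E : Names) : typS (ext b δ) E.bind (lift a) = lift (typS δ E a) :=
  typS_rename (δ' := ext b δ) (E' := E.bind) (ξ := fun n => n + 1) (ρ := fun n => n + 1)
    ⟨fun _ => rfl, fun _ _ => rfl, rfl⟩ ha ht

theorem typS_lift_bindKind {δ : ℕ → Bool} {a : Expr} (ha : Stratified δ a) (ht : isT δ a = false)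
    (b : Bool) (E : Names) : typS (ext b δ) E.bindKind (lift a) = lift (lift (typS δ E a)) :=
  (typS_rename (δ' := ext b δ) (E' := E.bindKind) (ξ := fun n => n + 1) (ρ := fun n => n + 2)
    ⟨fun _ => rfl, fun _ _ => rfl, rfl⟩ ha ht).trans (rename_rename _ _ _).symm

theorem typS_lift_erase {δ : ℕ → Bool} {a : Expr} (ha : Stratified δ a) (ht : isT δ a = false)
    (b : Bool) (E : Names) : typS (ext b δ) E.erase (lift a) = typS δ E a := by
  refine (typS_rename (δ' := ext b δ) (E' := E.erase) (ξ := fun n => n + 1) (ρ := fun n => n)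
    ⟨fun _ => rfl, fun _ _ => rfl, rfl⟩ ha ht).trans ?_
  rw [rename_eq_subst]
  exact subst_var _

/-- The source substitution `σ` and the target substitution `τ` agree as far as types are
concerned. -/
structure TypSubst (δ δ' : ℕ → Bool) (E E' : Names) (σ τ : ℕ → Expr) : Prop where
  isK : ∀ n, isK (σ n) = false
  isT : ∀ n, isT δ' (σ n) = δ n
  strat : ∀ n, Stratified δ' (σ n)
  typ : ∀ n, δ n = false → typS δ' E' (σ n) = τ (E.x n)
  zero : τ E.zero = var E'.zero

theorem Stratified.ups {δ : ℕ → Bool} {σ : ℕ → Expr} (h : ∀ n, Stratified δ (σ n)) (b : Bool)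
    (n : ℕ) : Stratified (ext b δ) (ups σ n) := by
  cases n with
  | zero => trivial
  | succ n => exact (h n).rename (ξ := fun n => n + 1) fun _ => rfl

theorem TypSubst.bind {δ δ' : ℕ → Bool} {E E' : Names} {σ τ : ℕ → Expr}
    (h : TypSubst δ δ' E E' σ τ) (b : Bool) :
    TypSubst (ext b δ) (ext b δ') E.bind E'.bind (ups σ) (ups τ) where
  isK := isK_ups h.isK
  isT := isT_ups h.isT b
  strat := Stratified.ups h.strat b
  typ n hn := by
    cases n with
    | zero => rfl
    | succ n =>
      exact (typS_lift_bind (h.strat n) ((h.isT n).trans hn) b E').trans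
        (congrArg lift (h.typ n hn))
  zero := congrArg lift h.zero

theorem TypSubst.bindKind {δ δ' : ℕ → Bool} {E E' : Names} {σ τ : ℕ → Expr}
    (h : TypSubst δ δ' E E' σ τ) (b : Bool) :
    TypSubst (ext b δ) (ext b δ') E.bindKind E'.bindKind (ups σ) (ups (ups τ)) where
  isK := isK_ups h.isK
  isT := isT_ups h.isT b
  strat := Stratified.ups h.strat b
  typ n hn := by
    cases n with
    | zero => rfl
    | succ n =>
      exact (typS_lift_bindKind (h.strat n) ((h.isT n).trans hn) b E').trans
        (congrArg (fun a => a.lift.lift) (h.typ n hn))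
  zero := congrArg (fun a => a.lift.lift) h.zero

theorem TypSubst.erase {δ δ' : ℕ → Bool} {E E' : Names} {σ τ : ℕ → Expr}
    (h : TypSubst δ δ' E E' σ τ) :
    TypSubst (ext true δ) (ext true δ') E.erase E'.erase (ups σ) τ where
  isK := isK_ups h.isK
  isT := isT_ups h.isT true
  strat := Stratified.ups h.strat true
  typ n hn := by
    cases n with
    | zero => cases hn
    | succ n =>
      exact (typS_lift_erase (h.strat n) ((h.isT n).trans hn) true E').trans (h.typ n hn)
  zero := h.zero

/-- Term arguments are erased, so only constructor variables matter. The condition on `isT` is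
essential, since on terms the dummy names could surface. -/
theorem typS_subst {δ δ' : ℕ → Bool} {E E' : Names} {σ τ : ℕ → Expr}
    (h : TypSubst δ δ' E E' σ τ) {a : Expr} (ha : Stratified δ a) (ht : isT δ a = false) :
    typS δ' E' (subst σ a) = subst τ (typS δ E a) := by
  induction a generalizing δ δ' E E' σ τ with
  | sort => exact h.zero.symm
  | var n => exact h.typ n ht
  | pi A B ihA ihB =>
    obtain ⟨h1, h2, h3, h4⟩ := ha
    simp only [subst, typS, isK_subst h.isK, ihA h h2 h1, ihB (h.bind _) h4 h3]
    split
    · rename_i hK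
      simp only [subst, subst_arrow, subst_ups_lift, subst_kindS, kindS_subst h.isK hK]
    · rfl
  | lam A b _ ih =>
    obtain ⟨h1, h2, h3⟩ := ha
    simp only [subst, typS, isK_subst h.isK, ih (h.bind _) h3 ht]
    split
    · rename_i hK
      simp only [subst, subst_kindS, kindS_subst h.isK hK]
    · rename_i hK
      -- The binder of a term variable is erased, so the target substitution stays the same under
      -- it.
      simp only [isT, Bool.eq_false_iff.2 hK, Bool.not_false] at h3 ht ⊢
      exact ih h.erase h3 ht
  | app a b iha ihb =>
    simp only [subst, typS, isT_subst h.isK h.isT, iha h ha.1 ht]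
    split
    · rfl
    · rename_i hb
      rw [ihb h ha.2 (Bool.eq_false_iff.2 hb), subst]

/-- The source renaming `ξ` and the target renaming `ρ` agree. -/
structure TrmRen (δ δ' : ℕ → Bool) (E E' : Names) (ξ ρ : ℕ → ℕ) : Prop where
  isT : ∀ n, δ' (ξ n) = δ n
  x : ∀ n, E'.x (ξ n) = ρ (E.x n)
  w : ∀ n, δ n = false → E'.w (ξ n) = ρ (E.w n)
  zero : E'.zero = ρ E.zero
  z : E'.z = ρ E.z

theorem TrmRen.typRen {δ δ' : ℕ → Bool} {E E' : Names} {ξ ρ : ℕ → ℕ} (h : TrmRen δ δ' E E' ξ ρ) :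
    TypRen δ δ' E E' ξ ρ :=
  ⟨h.isT, fun n _ => h.x n, h.zero⟩

theorem TrmRen.bind {δ δ' : ℕ → Bool} {E E' : Names} {ξ ρ : ℕ → ℕ} (h : TrmRen δ δ' E E' ξ ρ)
    (b : Bool) : TrmRen (ext b δ) (ext b δ') E.bind E'.bind (upr ξ) (upr ρ) where
  isT := ext_upr h.isT b
  x n := by
    cases n with
    | zero => rfl
    | succ n => exact congrArg (· + 1) (h.x n)
  w n hn := by
    cases n with
    | zero => rfl
    | succ n => exact congrArg (· + 1) (h.w n hn)
  zero := congrArg (· + 1) h.zero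
  z := congrArg (· + 1) h.z

theorem TrmRen.bindKind {δ δ' : ℕ → Bool} {E E' : Names} {ξ ρ : ℕ → ℕ}
    (h : TrmRen δ δ' E E' ξ ρ) (b : Bool) :
    TrmRen (ext b δ) (ext b δ') E.bindKind E'.bindKind (upr ξ) (upr (upr ρ)) where
  isT := ext_upr h.isT b
  x n := by
    cases n with
    | zero => rfl
    | succ n => exact congrArg (· + 2) (h.x n)
  w n hn := by
    cases n with
    | zero => rfl
    | succ n => exact congrArg (· + 2) (h.w n hn)
  zero := congrArg (· + 2) h.zero
  z := congrArg (· + 2) h.z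

theorem rename_prodConst {E E' : Names} {ρ : ℕ → ℕ} (h0 : E'.zero = ρ E.zero) (hz : E'.z = ρ E.z) :
    rename ρ (prodConst E) = prodConst E' := by
  simp only [prodConst, rename, rename_arrow, h0, hz]

theorem trmS_rename {δ δ' : ℕ → Bool} {E E' : Names} {ξ ρ : ℕ → ℕ} (h : TrmRen δ δ' E E' ξ ρ)
    {a : Expr} (ha : Stratified δ a) : trmS δ' E' (rename ξ a) = rename ρ (trmS δ E a) := by
  induction a generalizing δ δ' E E' ξ ρ with
  | sort => simp only [rename, trmS, h.zero, h.z]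
  | var n =>
    simp only [rename, trmS, h.isT, h.x]
    split
    · rfl
    · rename_i hn
      rw [h.w n (Bool.eq_false_iff.2 hn), rename]
  | pi A B ihA ihB =>
    obtain ⟨h1, h2, h3, h4⟩ := ha
    simp only [rename, trmS, isK_rename, ihA h h2, typS_rename h.typRen h2 h1]
    split
    · rename_i hK
      simp only [rename, rename_inst, ihB (h.bindKind _) h4, kindS_rename _ hK,
        rename_canon_kindS, rename_prodConst h.zero h.z, ← h.zero, ← h.z, rename_upr_lift]
    · simp only [rename, rename_inst, ihB (h.bind _) h4, rename_prodConst h.zero h.z, ← h.z]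
  | lam A b ihA ihb =>
    obtain ⟨h1, h2, h3⟩ := ha
    simp only [rename, trmS, isK_rename, ihA h h2, typS_rename h.typRen h2 h1]
    split
    · rename_i hK
      simp only [rename, rename_upr_lift, ihb (h.bindKind _) h3, kindS_rename _ hK,
        rename_kindS, h.zero]
    · simp only [rename, rename_upr_lift, ihb (h.bind _) h3, h.zero]
  | app a b iha ihb =>
    simp only [rename, trmS, isT_rename h.isT, iha h ha.1, ihb h ha.2]
    split
    · rfl
    · rename_i hb
      rw [typS_rename h.typRen ha.2 (Bool.eq_false_iff.2 hb), rename, rename]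

theorem trmS_lift_bind {δ : ℕ → Bool} {a : Expr} (ha : Stratified δ a) (b : Bool) (E : Names) :
    trmS (ext b δ) E.bind (lift a) = lift (trmS δ E a) :=
  trmS_rename (δ' := ext b δ) (E' := E.bind) (ξ := fun n => n + 1) (ρ := fun n => n + 1)
    ⟨fun _ => rfl, fun _ => rfl, fun _ _ => rfl, rfl, rfl⟩ ha

theorem trmS_lift_bindKind {δ : ℕ → Bool} {a : Expr} (ha : Stratified δ a) (b : Bool)
    (E : Names) : trmS (ext b δ) E.bindKind (lift a) = lift (lift (trmS δ E a)) :=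
  (trmS_rename (δ' := ext b δ) (E' := E.bindKind) (ξ := fun n => n + 1) (ρ := fun n => n + 2)
    ⟨fun _ => rfl, fun _ => rfl, fun _ _ => rfl, rfl, rfl⟩ ha).trans (rename_rename _ _ _).symm

/-- The source substitution `σ` and the target substitution `τ` agree. -/
structure TrmSubst (δ δ' : ℕ → Bool) (E E' : Names) (σ τ : ℕ → Expr) : Prop
    extends TypSubst δ δ' E E' σ τ where
  con : ∀ n, δ n = false → trmS δ' E' (σ n) = τ (E.w n)
  trm : ∀ n, δ n = true → trmS δ' E' (σ n) = τ (E.x n)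
  z : τ E.z = var E'.z

theorem TrmSubst.bind {δ δ' : ℕ → Bool} {E E' : Names} {σ τ : ℕ → Expr}
    (h : TrmSubst δ δ' E E' σ τ) :
    TrmSubst (ext true δ) (ext true δ') E.bind E'.bind (ups σ) (ups τ) where
  toTypSubst := h.toTypSubst.bind true
  con n hn := by
    cases n with
    | zero => cases hn
    | succ n =>
      exact (trmS_lift_bind (h.strat n) true E').trans (congrArg lift (h.con n hn))
  trm n hn := by
    cases n with
    | zero => rfl
    | succ n =>
      exact (trmS_lift_bind (h.strat n) true E').trans (congrArg lift (h.trm n hn))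
  z := congrArg lift h.z

theorem TrmSubst.bindKind {δ δ' : ℕ → Bool} {E E' : Names} {σ τ : ℕ → Expr}
    (h : TrmSubst δ δ' E E' σ τ) :
    TrmSubst (ext false δ) (ext false δ') E.bindKind E'.bindKind (ups σ) (ups (ups τ)) where
  toTypSubst := h.toTypSubst.bindKind false
  con n hn := by
    cases n with
    | zero => rfl
    | succ n =>
      exact (trmS_lift_bindKind (h.strat n) false E').trans
        (congrArg (fun a => a.lift.lift) (h.con n hn))
  trm n hn := by
    cases n with
    | zero => cases hn
    | succ n =>
      exact (trmS_lift_bindKind (h.strat n) false E').trans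
        (congrArg (fun a => a.lift.lift) (h.trm n hn))
  z := congrArg (fun a => a.lift.lift) h.z

theorem subst_prodConst {E E' : Names} {τ : ℕ → Expr} (h0 : τ E.zero = var E'.zero)
    (hz : τ E.z = var E'.z) : subst τ (prodConst E) = prodConst E' := by
  simp only [prodConst, subst, subst_arrow, h0, hz]

/-- This is an equality, not merely a reduction. The substitutions inside the clauses for products
commute with `τ` because `τ` sends `0` and `z` to their new names, and so maps canonical inhabitants
to canonical inhabitants. -/
theorem trmS_subst {δ δ' : ℕ → Bool} {E E' : Names} {σ τ : ℕ → Expr}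
    (h : TrmSubst δ δ' E E' σ τ) {a : Expr} (ha : Stratified δ a) :
    trmS δ' E' (subst σ a) = subst τ (trmS δ E a) := by
  induction a generalizing δ δ' E E' σ τ with
  | sort => simp only [subst, trmS, h.zero, h.z]
  | var n =>
    simp only [subst, trmS]
    split
    · exact h.trm n ‹_›
    · exact h.con n (Bool.eq_false_iff.2 ‹_›)
  | pi A B ihA ihB =>
    obtain ⟨h1, h2, h3, h4⟩ := ha
    simp only [subst, trmS, isK_subst h.isK, ihA h h2, typS_subst h.toTypSubst h2 h1]
    split
    · rename_i hK
      simp only [hK, Bool.not_true] at h4 ⊢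
      simp only [subst, subst_inst, ihB h.bindKind h4, kindS_subst h.isK hK,
        subst_canon_kindS h.zero h.z, subst_prodConst h.zero h.z, h.z, subst_ups_lift]
    · rename_i hK
      simp only [Bool.eq_false_iff.2 hK, Bool.not_false] at h4 ⊢
      simp only [subst, subst_inst, ihB h.bind h4, subst_prodConst h.zero h.z, h.z]
  | lam A b ihA ihb =>
    obtain ⟨h1, h2, h3⟩ := ha
    simp only [subst, trmS, isK_subst h.isK, ihA h h2, typS_subst h.toTypSubst h2 h1]
    split
    · rename_i hK
      simp only [hK, Bool.not_true] at h3 ⊢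
      simp only [subst, subst_ups_lift, ihb h.bindKind h3, kindS_subst h.isK hK,
        subst_kindS, h.zero]
    · rename_i hK
      simp only [Bool.eq_false_iff.2 hK, Bool.not_false] at h3 ⊢
      simp only [subst, subst_ups_lift, ihb h.bind h3, h.zero]
  | app a b iha ihb =>
    simp only [subst, trmS, isT_subst h.isK h.isT, iha h ha.1, ihb h ha.2]
    split
    · rfl
    · rename_i hb
      rw [typS_subst h.toTypSubst ha.2 (Bool.eq_false_iff.2 hb), subst, subst]

/-! ### Translations and reduction -/

theorem typSubst_single {δ : ℕ → Bool} {a : Expr} (hK : isK a = false) (ht : isT δ a = false)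
    (ha : Stratified δ a) (E : Names) :
    TypSubst (ext false δ) δ E.bind E (single a) (single (typS δ E a)) where
  isK n := by cases n <;> [exact hK; rfl]
  isT n := by cases n <;> [exact ht; rfl]
  strat n := by cases n <;> [exact ha; trivial]
  typ n _ := by cases n <;> rfl
  zero := rfl

/-- The target substitution is the identity, as a type never mentions the erased term variable. -/
theorem typSubst_single_erase {δ : ℕ → Bool} {a : Expr} (hK : isK a = false) (ht : isT δ a = true)
    (ha : Stratified δ a) (E : Names) :
    TypSubst (ext true δ) δ E.erase E (single a) var where
  isK n := by cases n <;> [exact hK; rfl]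
  isT n := by cases n <;> [exact ht; rfl]
  strat n := by cases n <;> [exact ha; trivial]
  typ n hn := by cases n <;> [cases hn; rfl]
  zero := rfl

/-- The simultaneous substitution of `b` for index `0` and `a` for index `1`. -/
def double (a b : Expr) : ℕ → Expr
  | 0 => b
  | 1 => a
  | n + 2 => var n

/-- The left side is what two successive contractions of `λ x. λ w^x. c` produce; the right side is
the form that `trmS_subst` delivers. -/
theorem inst_subst_single (c a b : Expr) :
    (subst (ups (single a)) c).inst b = subst (double a b) c := by
  rw [Expr.inst, subst_subst]
  congr 1
  funext n
  rcases n with _ | _ | n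
  · rfl
  · exact inst_lift a b
  · rfl

theorem trmSubst_double {δ : ℕ → Bool} {a : Expr} (hK : isK a = false) (ht : isT δ a = false)
    (ha : Stratified δ a) (E : Names) :
    TrmSubst (ext false δ) δ E.bindKind E (single a) (double (typS δ E a) (trmS δ E a)) where
  isK n := by cases n <;> [exact hK; rfl]
  isT n := by cases n <;> [exact ht; rfl]
  strat n := by cases n <;> [exact ha; trivial]
  typ n _ := by cases n <;> rfl
  zero := rfl
  con n hn := by
    cases n with
    | zero => rfl
    | succ n => exact if_neg (Bool.eq_false_iff.1 hn)
  trm n hn := by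
    cases n with
    | zero => cases hn
    | succ n => exact if_pos hn
  z := rfl

theorem trmSubst_single {δ : ℕ → Bool} {a : Expr} (hK : isK a = false) (ht : isT δ a = true)
    (ha : Stratified δ a) (E : Names) :
    TrmSubst (ext true δ) δ E.bind E (single a) (single (trmS δ E a)) where
  isK n := by cases n <;> [exact hK; rfl]
  isT n := by cases n <;> [exact ht; rfl]
  strat n := by cases n <;> [exact ha; trivial]
  typ n hn := by cases n <;> [cases hn; rfl]
  zero := rfl
  con n hn := by
    cases n with
    | zero => cases hn
    | succ n => exact if_neg (Bool.eq_false_iff.1 hn)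
  trm n hn := by
    cases n with
    | zero => rfl
    | succ n => exact if_pos hn
  z := rfl

/-- A kind is not itself a redex, and the redexes inside it lie in domains that are types, all of
which `V` discards. -/
theorem Typing.kindS_step {Γ : Ctx} {A A' T : Expr} (h : Typing rulesCC Γ A T) (hs : Step A A')
    (hK : isK A = true) : kindS A' = kindS A := by
  induction hs generalizing Γ T with
  | beta | lam1 | lam2 | app1 | app2 => cases hK
  | pi1 B hs ih =>
    obtain ⟨_, _, _, hA, _⟩ := h.pi_inv
    simp only [kindS, hA.isK_step hs]
    split
    · rw [ih hA ‹_›]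
    · rfl
  | pi2 A _ ih =>
    obtain ⟨_, _, _, _, hB, _⟩ := h.pi_inv
    simp only [kindS, ih hB hK]

/-- The type translation preserves reduction. -/
theorem Typing.typS_step {Γ : Ctx} {a a' T : Expr} (h : Typing rulesCC Γ a T) (hs : Step a a')
    (ht : isT (termVars Γ) a = false) (E : Names) :
    Steps (typS (termVars Γ) E a) (typS (termVars Γ) E a') := by
  induction hs generalizing Γ T E with
  | beta A b a =>
    obtain ⟨haK, haT, ha, hb⟩ := h.redex
    rw [isT, isT] at ht
    cases hK : isK A with
    | true =>
      simp only [hK, Bool.not_true] at haT hb ht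
      simp only [typS, haT, hK, if_true, Bool.not_true, Bool.false_eq_true, if_false]
      rw [Expr.inst, typS_subst (typSubst_single haK haT ha E) hb ht]
      exact Relation.ReflTransGen.single (Step.beta _ _ _)
    | false =>
      simp only [hK, Bool.not_false] at haT hb ht
      simp only [typS, haT, hK, if_true, Bool.not_false, Bool.false_eq_true, if_false]
      -- Both abstraction and argument are erased, so redex and contractum have equal translations;
      -- this is why only `Steps` can be claimed.
      rw [Expr.inst, typS_subst (typSubst_single_erase haK haT ha E) hb ht, subst_var]
      exact .refl _
  | pi1 B hs ih =>
    obtain ⟨_, _, _, hA, _⟩ := h.pi_inv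
    have ih := ih hA hA.isT_of_sort E
    simp only [typS, hA.isK_step hs]
    split
    · rename_i hK
      rw [hA.kindS_step hs hK]
      exact .pi (.refl _) (.pi (ih.rename _) (.refl _))
    · exact .pi ih (.refl _)
  | pi2 A _ ih =>
    obtain ⟨_, _, _, _, hB, _⟩ := h.pi_inv
    have ih := fun E => ih hB hB.isT_of_sort E
    simp only [typS]
    split
    · exact .pi (.refl _) (.pi (.refl _) ((ih _).rename _))
    · exact .pi (.refl _) (ih _)
  | lam1 b hs ih =>
    obtain ⟨_, _, hP, hb, _⟩ := h.lam_inv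
    obtain ⟨_, _, _, hA, _⟩ := hP.pi_inv
    simp only [typS, hA.isK_step hs]
    split
    · rename_i hK
      rw [hA.kindS_step hs hK]
      exact .refl _
    · exact .refl _
  | lam2 A _ ih =>
    obtain ⟨_, _, hP, hb, _⟩ := h.lam_inv
    have ih := fun E => ih hb ht E
    simp only [typS]
    split
    · exact .lam (.refl _) (ih _)
    · exact ih _
  | app1 b _ ih =>
    obtain ⟨_, _, ha, _⟩ := h.app_inv
    have ih := ih ha ht E
    simp only [typS]
    split
    · exact ih
    · exact ih.app (.refl _)
  | app2 a hs ih =>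
    obtain ⟨_, _, _, hb, _⟩ := h.app_inv
    simp only [typS, hb.isT_step hs]
    split
    · exact .refl _
    · exact .app (.refl _) (ih hb (Bool.eq_false_iff.2 ‹_›) E)

theorem StepPlus.trans_steps {a b c : Expr} (h : StepPlus a b) (h' : Steps b c) : StepPlus a c :=
  Relation.TransGen.trans_left h h'

theorem Steps.trans_stepPlus {a b c : Expr} (h : Steps a b) (h' : StepPlus b c) : StepPlus a c :=
  Relation.TransGen.trans_right h h'

theorem StepPlus.app_left {a a' b b' : Expr} (ha : StepPlus a a') (hb : Steps b b') :
    StepPlus (app a b) (app a' b') :=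
  (ha.map (f := fun a => app a b) fun _ _ => Step.app1 b).trans_steps (.app (.refl _) hb)

theorem StepPlus.app_right {a a' b b' : Expr} (ha : Steps a a') (hb : StepPlus b b') :
    StepPlus (app a b) (app a' b') :=
  (Steps.app ha (.refl _)).trans_stepPlus (hb.map (f := fun b => app a' b) fun _ _ => Step.app2 a')

theorem StepPlus.lam_right (A : Expr) {b b' : Expr} (hb : StepPlus b b') :
    StepPlus (lam A b) (lam A b') :=
  hb.map fun _ _ => Step.lam2 A

theorem StepPlus.lift {a b : Expr} (h : StepPlus a b) : StepPlus a.lift b.lift := by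
  simpa only [Expr.lift, rename_eq_subst] using h.subst _

theorem StepPlus.inst {a a' : Expr} (h : StepPlus a a') (b : Expr) :
    StepPlus (a.inst b) (a'.inst b) :=
  h.subst _

theorem Steps.lift {a b : Expr} (h : Steps a b) : Steps a.lift b.lift :=
  h.rename _

/-- The term translation preserves reduction. -/
theorem Typing.trmS_step {Γ : Ctx} {a a' T : Expr} (h : Typing rulesCC Γ a T) (hs : Step a a')
    (E : Names) : StepPlus (trmS (termVars Γ) E a) (trmS (termVars Γ) E a') := by
  induction hs generalizing Γ T E with
  | beta A b a =>
    obtain ⟨haK, haT, ha, hb⟩ := h.redex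
    cases hK : isK A with
    | true =>
      simp only [hK, Bool.not_true] at haT hb
      simp only [trmS, haT, hK, if_true, Bool.not_true, Bool.false_eq_true, if_false]
      rw [Expr.inst, trmS_subst (trmSubst_double haK haT ha E) hb, ← inst_subst_single]
      -- The dummy argument `[A]` is dropped first; then `x` receives the translated type and `w^x`
      -- the translated term.
      refine .head (.app1 _ (.app1 _ (.beta _ _ _))) ?_
      rw [inst_lift]
      exact .head (.app1 _ (.beta _ _ _)) (.single (.beta _ _ _))
    | false =>
      simp only [hK, Bool.not_false] at haT hb
      simp only [trmS, haT, hK, if_true, Bool.not_false, Bool.false_eq_true, if_false]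
      rw [Expr.inst, trmS_subst (trmSubst_single haK haT ha E) hb]
      refine .head (.app1 _ (.beta _ _ _)) ?_
      rw [inst_lift]
      exact .single (.beta _ _ _)
  | pi1 B hs ih =>
    obtain ⟨_, _, _, hA, _⟩ := h.pi_inv
    have ht := hA.typS_step hs hA.isT_of_sort E
    -- The copy of `[A]` supplies the strict step; the copies of `⟨A⟩` in the substituted constants
    -- follow in any number of steps.
    have ih := StepPlus.app_right (.refl (prodConst E)) (ih hA E)
    simp only [trmS, hA.isK_step hs]
    split
    · rename_i hK
      rw [hA.kindS_step hs hK]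
      exact ih.app_left ((Steps.inst_right _ (Steps.app (.refl _) ht).lift).subst _)
    · exact ih.app_left (Steps.inst_right _ (.app (.refl _) ht))
  | pi2 A _ ih =>
    obtain ⟨_, _, _, _, hB, _⟩ := h.pi_inv
    have ih := fun E => ih hB E
    simp only [trmS]
    split
    · exact .app_right (.refl _) (((ih _).inst _).inst _)
    · exact .app_right (.refl _) ((ih _).inst _)
  | lam1 b hs ih =>
    obtain ⟨_, _, hP, hb, _⟩ := h.lam_inv
    obtain ⟨_, _, _, hA, _⟩ := hP.pi_inv
    have ht := hA.typS_step hs hA.isT_of_sort E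
    have ih := ih hA E
    simp only [trmS, hA.isK_step hs]
    split
    · rename_i hK
      rw [hA.kindS_step hs hK]
      -- The dummy argument pays off here: `V(A)` is unchanged and `⟨A⟩` may be, so only `[A]` is
      -- certain to move.
      exact .app_right (.lam (.refl _) (Steps.lam (.refl _) (.lam ht.lift (.refl _))).lift) ih
    · exact .app_right (.lam (.refl _) (Steps.lam ht (.refl _)).lift) ih
  | lam2 A _ ih =>
    obtain ⟨_, _, hP, hb, _⟩ := h.lam_inv
    have ih := fun E => ih hb E
    simp only [trmS]
    split
    · exact .app_left (.lam_right _ (((ih _).lam_right _).lam_right _).lift) (.refl _)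
    · exact .app_left (.lam_right _ ((ih _).lam_right _).lift) (.refl _)
  | app1 b _ ih =>
    obtain ⟨_, _, ha, _⟩ := h.app_inv
    have ih := ih ha E
    simp only [trmS]
    split
    · exact ih.app_left (.refl _)
    · exact (ih.app_left (.refl _)).app_left (.refl _)
  | app2 a hs ih =>
    obtain ⟨_, _, _, hb, _⟩ := h.app_inv
    simp only [trmS, hb.isT_step hs]
    split
    · exact .app_right (.refl _) (ih hb E)
    · exact .app_right (.app (.refl _) (hb.typS_step hs (Bool.eq_false_iff.2 ‹_›) E)) (ih hb E)

end PTS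

theorem mainTheorem5 (Γ : PTS.Ctx) (a A a' : PTS.Expr)
    (ha : PTS.Typing PTS.rulesCC Γ a A) (hstep : PTS.Step a a') :
    PTS.StepPlus (PTS.trm Γ a) (PTS.trm Γ a') := by
  -- Subject reduction makes the reduct typable too, so both translations may be replaced by their
  -- structural versions. The names come from `Γ` alone and are the same on both sides.
  rw [PTS.trm, PTS.trm, ha.trmAux_eq, (ha.step hstep).trmAux_eq]
  exact ha.trmS_step hstep _
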